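/- **Setting.** The classical dynamic program for matrix chain multiplication takes the dimensions $d_0,\dots,d_n$ of a chain of $n$ matrices, sets $S(i,i)=0$ for $1\le i\le n$, and computes, for $1\le i<j\le n$, $$S(i,j)=\min_{i\le k<j}\ \bigl(S(i,k)+S(k+1,j)+d_{i-1}d_kd_j\bigr),$$ with output $S(1,n)$. It is viewed as a computational DAG. Its input vertices are $d_0,\dots,d_n$ and $S(1,1),\dots,S(n,n)$. For every $1\le i\le k<j\le n$ there are four separate unit binary operations: $d_{i-1}d_k$, then $(d_{i-1}d_k)d_j$, then $S(i,k)+S(k+1,j)$, and finally the sum $q_{i,k,j}$ of the last two. For every $i<j$, the value $S(i,j)$ is obtained from $q_{i,i,j},\dots,q_{i,j-1,j}$ by binary minima arranged along some binary tree with these $j-i$ leaves (when $j=i+1$, $S(i,j)=q_{i,i,j}$); the trees are part of the choice of a schedule. Each value occupies one memory word. The machine has a cache of $M$ words and an unbounded slow memory. An operation can be executed only when its operands are in the cache, and its result is put in the cache. One I/O operation (a read or a write) copies up to $B$ words between consecutive locations of slow memory and consecutive locations of the cache; operations and copies inside the cache are free. Initially the cache is empty and the slow memory contains exactly $d_0,\dots,d_n,S(1,1),\dots,S(n,n)$,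 in this order; at the end $S(1,n)$ must be in slow memory. Let $IO_{MCM}(n,M,B)$ be the minimum number of I/O operations over all choices of the aggregation trees and all schedules in which no value is computed more than once. **Theorem.** There are absolute constants $c,c_1,c_2>0$ such that for all natural numbers $n,M,B$ with $M\ge 2$, $1\le B\le M$ and $M<cn^2$, a schedule as above exists and $$c_1\,\frac{n^3}{B\sqrt M}\ \le\ IO_{MCM}(n,M,B)\ \le\ c_2\,\frac{n^3}{B\sqrt M}.$$ In other words, $IO_{MCM}(n,M,B)\in\Theta\bigl(n^3/(B\sqrt M)\bigr)$ for $M<cn^2$. -/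

import Mathlib

/-! ### Computational DAGs -/

/-- A computational directed acyclic graph: `verts` are the values (inputs and results of unit
operations), and `Adj u v` says that `u` is an operand of the operation that computes `v`. -/
structure CDAG (V : Type) where
  verts : Set V
  Adj : V → V → Prop
  left_mem : ∀ {u v}, Adj u v → u ∈ verts
  right_mem : ∀ {u v}, Adj u v → v ∈ verts
  acyclic : WellFounded Adj

namespace CDAG

variable {V : Type}

/-- Input vertices: no predecessors. -/
def IsInput (G : CDAG V) (v : V) : Prop := v ∈ G.verts ∧ ∀ u, ¬ G.Adj u v

/-- Output vertices: no successors. -/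
def IsOutput (G : CDAG V) (v : V) : Prop := v ∈ G.verts ∧ ∀ w, ¬ G.Adj v w

end CDAG

/-! ### Two-level memory with block transfers -/

/-- Contents of the memory: a cache with `M` words and an unbounded slow memory. A word is empty
or holds the value of a vertex. -/
structure Memory (V : Type) (M : ℕ) where
  cache : Fin M → Option V
  slow : ℕ → Option V

/-- One step of a schedule.
* `read a p b`: copy the `b` consecutive words of slow memory from address `a` on
  to the `b` consecutive cache words from position `p` on;
* `write p a b`: copy `b` consecutive cache words from `p` on to slow memory from `a` on;
* `compute v p`: perform the operation computing `v` and put the result in cache word `p`;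
* `copy p q`: copy cache word `p` to cache word `q`. -/
inductive MemAction (V : Type) (M : ℕ) where
  | read (a p b : ℕ)
  | write (p a b : ℕ)
  | compute (v : V) (p : Fin M)
  | copy (p q : Fin M)

namespace MemAction

variable {V : Type} {M : ℕ}

/-- When an action may be executed, if one transfer moves at most `B` words. -/
def Allowed (G : CDAG V) (B : ℕ) (s : Memory V M) : MemAction V M → Prop
  | read _ p b => b ≤ B ∧ p + b ≤ M
  | write p _ b => b ≤ B ∧ p + b ≤ M
  | compute v _ => v ∈ G.verts ∧ ¬ G.IsInput v ∧ ∀ u, G.Adj u v → ∃ r, s.cache r = some u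
  | copy _ _ => True

/-- The memory after an action. -/
def effect (s : Memory V M) : MemAction V M → Memory V M
  | read a p b =>
      { s with cache := fun r =>
          if p ≤ (r : ℕ) ∧ (r : ℕ) < p + b then s.slow (a + ((r : ℕ) - p)) else s.cache r }
  | write p a b =>
      { s with slow := fun x =>
          if a ≤ x ∧ x < a + b then
            (if h : p + (x - a) < M then s.cache ⟨p + (x - a), h⟩ else none)
          else s.slow x }
  | compute v p => { s with cache := fun r => if r = p then some v else s.cache r }
  | copy p q => { s with cache := fun r => if r = q then s.cache p else s.cache r }

/-- Reads and writes are charged one unit each; everything else is free. -/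
def cost : MemAction V M → ℕ
  | read _ _ _ => 1
  | write _ _ _ => 1
  | compute _ _ => 0
  | copy _ _ => 0

/-- The vertex computed by an action, if any. -/
def computed : MemAction V M → Option V
  | compute v _ => some v
  | _ => none

end MemAction

namespace Schedule

variable {V : Type} {M : ℕ}

/-- Every action of the schedule may be executed at its turn. -/
def Legal (G : CDAG V) (B : ℕ) : Memory V M → List (MemAction V M) → Prop
  | _, [] => True
  | s, x :: xs => x.Allowed G B s ∧ Legal G B (x.effect s) xs

/-- The memory after the schedule. -/
def final (s : Memory V M) (xs : List (MemAction V M)) : Memory V M :=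
  xs.foldl MemAction.effect s

/-- The number of read and write operations of the schedule. -/
def cost (xs : List (MemAction V M)) : ℕ := (xs.map MemAction.cost).sum

/-- The schedule evaluates `G` without recomputation: starting with an empty cache and with
`input` in slow memory, all actions are legal, no vertex is computed twice, and at the end
every output is in slow memory. -/
structure Evaluates (G : CDAG V) (input : ℕ → Option V) (B : ℕ)
    (xs : List (MemAction V M)) : Prop where
  legal : Legal G B ⟨fun _ => none, input⟩ xs
  no_recomputation : (xs.filterMap MemAction.computed).Nodup
  output : ∀ v, G.IsOutput v → ∃ a, (final ⟨fun _ => none, input⟩ xs).slow a = some v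

end Schedule

/-! ### The CDAGs of the matrix chain multiplication algorithm -/

/-- Binary trees whose leaves carry a split position `k`. -/
inductive AggTree where
  | leaf (k : ℕ)
  | node (l r : AggTree)

namespace AggTree

/-- Leaf labels from left to right. -/
def leaves : AggTree → List ℕ
  | leaf k => [k]
  | node l r => l.leaves ++ r.leaves

/-- Number of nodes. -/
def size : AggTree → ℕ
  | leaf _ => 1
  | node l r => l.size + r.size + 1

/-- `IsSubtree t T`: `t` is the subtree of `T` below one of its nodes. -/
def IsSubtree (t : AggTree) : AggTree → Prop
  | leaf k => t = leaf k
  | node l r => t = node l r ∨ IsSubtree t l ∨ IsSubtree t r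

theorem sub_refl : ∀ t : AggTree, IsSubtree t t
  | leaf _ => rfl
  | node _ _ => Or.inl rfl

theorem sub_left {l r : AggTree} : ∀ {T : AggTree}, IsSubtree (node l r) T → IsSubtree l T
  | leaf _, h => by cases h
  | node a b, h => by
      rcases h with h | h | h
      · cases h; exact Or.inr (Or.inl (sub_refl _))
      · exact Or.inr (Or.inl (sub_left h))
      · exact Or.inr (Or.inr (sub_left h))

theorem sub_right {l r : AggTree} : ∀ {T : AggTree}, IsSubtree (node l r) T → IsSubtree r T
  | leaf _, h => by cases h
  | node a b, h => by
      rcases h with h | h | h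
      · cases h; exact Or.inr (Or.inr (sub_refl _))
      · exact Or.inr (Or.inl (sub_right h))
      · exact Or.inr (Or.inr (sub_right h))

theorem mem_leaves_of_sub {k : ℕ} : ∀ {T : AggTree}, IsSubtree (leaf k) T → k ∈ T.leaves
  | leaf _, h => by cases h; simp [leaves]
  | node a b, h => by
      rcases h with h | h | h
      · cases h
      · simp [leaves, mem_leaves_of_sub h]
      · simp [leaves, mem_leaves_of_sub h]

end AggTree

/-- An order of aggregation for chains of `n` matrices: for every `1 ≤ i < j ≤ n` a binary tree
whose leaves are the split positions `k = i, …, j - 1`, each occurring once. It prescribes how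
the minimum defining `S(i,j)` is evaluated by binary minima. -/
structure AggOrder (n : ℕ) where
  tree : ℕ → ℕ → AggTree
  leaves_perm : ∀ i j, 1 ≤ i → i < j → j ≤ n →
    (tree i j).leaves.Perm (List.range' i (j - i))

/-- Names of the values occurring in the algorithm.
* `dim m` is `d_m`, and `init i` is `S(i,i)`;
* `dd i k j` is `d_{i-1} * d_k`, and `ddd i k j` is `(d_{i-1} * d_k) * d_j`;
* `sum i k j` is `S(i,k) + S(k+1,j)`;
* `agg i j (leaf k)` is `(S(i,k) + S(k+1,j)) + d_{i-1} * d_k * d_j`, and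
  `agg i j (node l r)` is `min (agg i j l) (agg i j r)`. -/
inductive MCMVertex where
  | dim (m : ℕ)
  | init (i : ℕ)
  | dd (i k j : ℕ)
  | ddd (i k j : ℕ)
  | sum (i k j : ℕ)
  | agg (i j : ℕ) (t : AggTree)

namespace MCM

open MCMVertex AggTree

/-- The vertex holding the solution `S(i,j)` of a subproblem. -/
def S {n : ℕ} (T : AggOrder n) (i j : ℕ) : MCMVertex :=
  if i = j then init i else agg i j (T.tree i j)

/-- The vertices of the CDAG. -/
def IsVertex {n : ℕ} (T : AggOrder n) : MCMVertex → Prop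
  | dim m => m ≤ n
  | init i => 1 ≤ i ∧ i ≤ n
  | dd i k j => 1 ≤ i ∧ i ≤ k ∧ k < j ∧ j ≤ n
  | ddd i k j => 1 ≤ i ∧ i ≤ k ∧ k < j ∧ j ≤ n
  | sum i k j => 1 ≤ i ∧ i ≤ k ∧ k < j ∧ j ≤ n
  | agg i j t => 1 ≤ i ∧ i < j ∧ j ≤ n ∧ IsSubtree t (T.tree i j)

/-- `Operand T u v`: the value `u` is an operand in the computation of `v`. -/
inductive Operand {n : ℕ} (T : AggOrder n) : MCMVertex → MCMVertex → Prop
  | dd_left {i k j} : IsVertex T (dd i k j) → Operand T (dim (i - 1)) (dd i k j)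
  | dd_right {i k j} : IsVertex T (dd i k j) → Operand T (dim k) (dd i k j)
  | ddd_left {i k j} : IsVertex T (ddd i k j) → Operand T (dd i k j) (ddd i k j)
  | ddd_right {i k j} : IsVertex T (ddd i k j) → Operand T (dim j) (ddd i k j)
  | sum_left {i k j} : IsVertex T (sum i k j) → Operand T (S T i k) (sum i k j)
  | sum_right {i k j} : IsVertex T (sum i k j) → Operand T (S T (k + 1) j) (sum i k j)
  | leaf_left {i k j} : IsVertex T (agg i j (leaf k)) →
      Operand T (sum i k j) (agg i j (leaf k))
  | leaf_right {i k j} : IsVertex T (agg i j (leaf k)) →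
      Operand T (ddd i k j) (agg i j (leaf k))
  | node_left {i j l r} : IsVertex T (agg i j (node l r)) →
      Operand T (agg i j l) (agg i j (node l r))
  | node_right {i j l r} : IsVertex T (agg i j (node l r)) →
      Operand T (agg i j r) (agg i j (node l r))

theorem isVertex_S {n : ℕ} (T : AggOrder n) {i j : ℕ} (hi : 1 ≤ i) (hij : i ≤ j) (hj : j ≤ n) :
    IsVertex T (S T i j) := by
  unfold S
  split_ifs with h
  · exact ⟨hi, h ▸ hj⟩
  · exact ⟨hi, lt_of_le_of_ne hij h, hj, sub_refl _⟩

theorem leaf_bounds {n : ℕ} (T : AggOrder n) {i j k : ℕ} (h : IsVertex T (agg i j (leaf k))) :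
    1 ≤ i ∧ i ≤ k ∧ k < j ∧ j ≤ n := by
  obtain ⟨h1, h2, h3, h4⟩ := h
  have := (T.leaves_perm i j h1 h2 h3).mem_iff.1 (mem_leaves_of_sub h4)
  rw [List.mem_range'_1] at this
  omega

theorem operand_right {n : ℕ} {T : AggOrder n} {u v : MCMVertex} (h : Operand T u v) :
    IsVertex T v := by
  cases h <;> assumption

theorem operand_left {n : ℕ} {T : AggOrder n} {u v : MCMVertex} (h : Operand T u v) :
    IsVertex T u := by
  cases h with
  | dd_left h => obtain ⟨h1, h2, h3, h4⟩ := h; change _ ≤ n; omega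
  | dd_right h => obtain ⟨h1, h2, h3, h4⟩ := h; change _ ≤ n; omega
  | ddd_left h => exact h
  | ddd_right h => exact h.2.2.2
  | sum_left h => obtain ⟨h1, h2, h3, h4⟩ := h; exact isVertex_S T h1 h2 (by omega)
  | sum_right h => obtain ⟨h1, h2, h3, h4⟩ := h; exact isVertex_S T (by omega) h3 h4
  | leaf_left h => exact leaf_bounds T h
  | leaf_right h => exact leaf_bounds T h
  | node_left h => exact ⟨h.1, h.2.1, h.2.2.1, sub_left h.2.2.2⟩
  | node_right h => exact ⟨h.1, h.2.1, h.2.2.1, sub_right h.2.2.2⟩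

/-- A rank that increases along edges. -/
def rank : MCMVertex → ℕ ×ₗ ℕ
  | dim _ => toLex (0, 0)
  | init _ => toLex (0, 0)
  | dd i _ j => toLex (j - i, 0)
  | ddd i _ j => toLex (j - i, 1)
  | sum i _ j => toLex (j - i, 1)
  | agg i j t => toLex (j - i, 1 + t.size)

theorem rank_S {n : ℕ} (T : AggOrder n) (i j m x : ℕ) (h : j - i < m) :
    rank (S T i j) < toLex (m, x) := by
  unfold S
  split_ifs with hij
  · exact Prod.Lex.toLex_lt_toLex.2 (Or.inl (by simp; omega))
  · exact Prod.Lex.toLex_lt_toLex.2 (Or.inl h)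

theorem rank_lt {n : ℕ} {T : AggOrder n} {u v : MCMVertex} (h : Operand T u v) :
    rank u < rank v := by
  cases h with
  | dd_left h => exact Prod.Lex.toLex_lt_toLex.2 (Or.inl (by have := h.2; simp; omega))
  | dd_right h => exact Prod.Lex.toLex_lt_toLex.2 (Or.inl (by have := h.2; simp; omega))
  | ddd_left h => exact Prod.Lex.toLex_lt_toLex.2 (Or.inr ⟨rfl, by simp⟩)
  | ddd_right h => exact Prod.Lex.toLex_lt_toLex.2 (Or.inl (by have := h.2; simp; omega))
  | sum_left h => exact rank_S T _ _ _ _ (by have := h.2; omega)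
  | sum_right h => exact rank_S T _ _ _ _ (by have := h.2; omega)
  | leaf_left h => exact Prod.Lex.toLex_lt_toLex.2 (Or.inr ⟨rfl, by simp [size]⟩)
  | leaf_right h => exact Prod.Lex.toLex_lt_toLex.2 (Or.inr ⟨rfl, by simp [size]⟩)
  | node_left h => exact Prod.Lex.toLex_lt_toLex.2 (Or.inr ⟨rfl, by simp [size]⟩)
  | node_right h => exact Prod.Lex.toLex_lt_toLex.2 (Or.inr ⟨rfl, by simp [size]⟩)

/-- The CDAG of the algorithm on `n` matrices, for a given order of aggregation. -/
def cdag {n : ℕ} (T : AggOrder n) : CDAG MCMVertex where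
  verts := {v | IsVertex T v}
  Adj := Operand T
  left_mem := operand_left
  right_mem := operand_right
  acyclic := Subrelation.wf (fun h => rank_lt h) (InvImage.wf rank wellFounded_lt)

/-- The initial slow memory: `d_0, …, d_n` followed by `S(1,1), …, S(n,n)`. -/
def input (n : ℕ) : ℕ → Option MCMVertex := fun a =>
  if a ≤ n then some (dim a) else if a ≤ 2 * n then some (init (a - n)) else none

/-- The numbers of read and write operations of all schedules without recomputation of the
algorithm on `n` matrices, with a cache of `M` words and blocks of at most `B` words. The
schedule is free to choose the order of aggregation. -/
def transferCounts (n M B : ℕ) : Set ℕ :=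
  {q | ∃ (T : AggOrder n) (xs : List (MemAction MCMVertex M)),
    Schedule.Evaluates (cdag T) (input n) B xs ∧ Schedule.cost xs = q}

end MCM

/-! Lower bound. Cut a schedule into parts with at most `Q = M / B` transfers and at most `X`
computed sums `S(i,k) + S(k+1,j)` each. The words that cross the boundary of a part (cache before,
traffic, cache after) number at most `2M + BQ ≤ 3M`. Call a subproblem touched if one of its sums or
partial minima is computed in the part or crosses its boundary. The sums and minima of one
subproblem form a connected tree, and nothing is computed twice. So if none of them crosses the
boundary, all or none are computed inside the part. Hence a touched subproblem owns a boundary word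
or is solved entirely inside. A long subproblem solved inside uses up order `n` sums, so the cap
`X`, of order `M^{3/2}`, leaves at most `M` of these, because `√M` is far below `n`.

A sum for `(i,k,j)` touches `(i,j)`, `(i,k)` and `(k+1,j)`. By Loomis–Whitney a part therefore
computes `O(M^{3/2})` sums over a box of order `n³` triples in which all three subproblems are long.
All these sums must be computed, which forces order `n³/M^{3/2}` parts. Reaching the cap `X`
accounts for only a small fraction of them; the others use up `Q` transfers each. The carriers are
`computed_iff_of_edge`, `card_touched_le`, `Finset.card_sq_le_of_projections` and
`List.exists_chunks`.

Upper bound. Index `S(a+1,b)` by the cell `(a,b)` with `0 ≤ a < b ≤ n`. The recursion then combines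
the cells `(a,k)` and `(k,b)`, as in a (min,+) matrix product. Tiles of side `t`, of order `√M`, are
computed in order of distance from the diagonal. For each block of split positions strictly between
the row and column blocks, two finished tiles are loaded and used for the whole target tile. The
splits in the row and column blocks come last, in a phase that also reads entries of the target tile
itself. The aggregation trees are left combs following this order, so every running minimum is a
vertex of the CDAG (`isSubtree_comb`). There are `O((n/t)³)` tile transfers, each of `O(M/B)`
operations. For `M < 9` it suffices to evaluate one vertex at a time. -/

/-! ### Schedules: concatenation and traffic -/

namespace MemAction

variable {V : Type} {M : ℕ}

/-- The words copied by a transfer. -/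
def words (s : Memory V M) : MemAction V M → List (Option V)
  | read a _ b => (List.range b).map fun x => s.slow (a + x)
  | write p _ b => (List.range b).map fun x =>
      if h : p + x < M then s.cache ⟨p + x, h⟩ else none
  | compute _ _ => []
  | copy _ _ => []

theorem length_words_le {G : CDAG V} {B : ℕ} {s : Memory V M} {x : MemAction V M}
    (h : x.Allowed G B s) : (x.words s).length ≤ B * x.cost := by
  cases x <;> simp_all [words, cost, Allowed]

end MemAction

namespace Memory

variable {V : Type} {M : ℕ}

/-- The value `v` is stored somewhere in the cache. -/
def InCache (s : Memory V M) (v : V) : Prop := ∃ r, s.cache r = some v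

/-- The value `v` is stored somewhere in slow memory. -/
def InSlow (s : Memory V M) (v : V) : Prop := ∃ a, s.slow a = some v

end Memory

namespace MemAction

open Memory

variable {V : Type} {M : ℕ} {s : Memory V M} {x : MemAction V M} {v : V}

theorem inCache_effect (h : (x.effect s).InCache v) :
    s.InCache v ∨ some v ∈ x.words s ∨ x.computed = some v := by
  obtain ⟨r, hr⟩ := h
  cases x with
  | read a p b =>
    simp only [effect] at hr
    split_ifs at hr with hc
    · right; left
      simp only [words, List.mem_map, List.mem_range]
      exact ⟨(r : ℕ) - p, by omega, hr⟩
    · exact Or.inl ⟨r, hr⟩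
  | write p a b => exact Or.inl ⟨r, hr⟩
  | compute w p =>
    simp only [effect] at hr
    split_ifs at hr with hc
    · exact Or.inr (Or.inr hr)
    · exact Or.inl ⟨r, hr⟩
  | copy p q =>
    simp only [effect] at hr
    split_ifs at hr with hc
    · exact Or.inl ⟨p, hr⟩
    · exact Or.inl ⟨r, hr⟩

theorem inSlow_effect (h : (x.effect s).InSlow v) :
    s.InSlow v ∨ some v ∈ x.words s := by
  obtain ⟨y, hy⟩ := h
  cases x with
  | read a p b => exact Or.inl ⟨y, hy⟩
  | write p a b =>
    simp only [effect] at hy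
    split_ifs at hy with hc hd
    · right
      simp only [words, List.mem_map, List.mem_range]
      exact ⟨y - a, by omega, by simp [hd, hy]⟩
    · exact Or.inl ⟨y, hy⟩
  | compute w p => exact Or.inl ⟨y, hy⟩
  | copy p q => exact Or.inl ⟨y, hy⟩

theorem inMemory_of_mem_words (h : some v ∈ x.words s) : s.InCache v ∨ s.InSlow v := by
  cases x with
  | read a p b =>
    simp only [words, List.mem_map] at h
    obtain ⟨y, -, hy⟩ := h
    exact Or.inr ⟨_, hy⟩
  | write p a b =>
    simp only [words, List.mem_map] at h
    obtain ⟨y, -, hy⟩ := h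
    split_ifs at hy with hc
    exact Or.inl ⟨_, hy⟩
  | compute w p => simp [words] at h
  | copy p q => simp [words] at h

end MemAction

namespace Schedule

open Memory

variable {V : Type} {M : ℕ} {G : CDAG V} {B : ℕ}

theorem final_append (s : Memory V M) (xs ys : List (MemAction V M)) :
    final s (xs ++ ys) = final (final s xs) ys := by simp [final]

theorem final_cons (s : Memory V M) (x : MemAction V M) (ys : List (MemAction V M)) :
    final s (x :: ys) = final (x.effect s) ys := rfl

theorem cost_append (xs ys : List (MemAction V M)) : cost (xs ++ ys) = cost xs + cost ys := by
  simp [cost]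

theorem cost_cons (x : MemAction V M) (ys : List (MemAction V M)) :
    cost (x :: ys) = x.cost + cost ys := by
  simp [cost]

theorem legal_append {s : Memory V M} {xs ys : List (MemAction V M)} :
    Legal G B s (xs ++ ys) ↔ Legal G B s xs ∧ Legal G B (final s xs) ys := by
  induction xs generalizing s with
  | nil => simp [Legal, final]
  | cons x xs ih => simp [Legal, final_cons, ih, and_assoc]

/-- The vertices computed by a schedule, in order. -/
def computedList (xs : List (MemAction V M)) : List V := xs.filterMap MemAction.computed

theorem computedList_append (xs ys : List (MemAction V M)) :
    computedList (xs ++ ys) = computedList xs ++ computedList ys := by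
  simp [computedList]

/-- The words copied by the transfers of a schedule. -/
def traffic : Memory V M → List (MemAction V M) → List (Option V)
  | _, [] => []
  | s, x :: xs => x.words s ++ traffic (x.effect s) xs

theorem length_traffic_le {s : Memory V M} {xs : List (MemAction V M)} (h : Legal G B s xs) :
    (traffic s xs).length ≤ B * cost xs := by
  induction xs generalizing s with
  | nil => simp [traffic]
  | cons x xs ih =>
    simp only [traffic, List.length_append, cost_cons, mul_add]
    exact Nat.add_le_add (MemAction.length_words_le h.1) (ih h.2)

theorem mem_computedList_cons {x : MemAction V M} {xs : List (MemAction V M)} {v : V} :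
    v ∈ computedList (x :: xs) ↔ x.computed = some v ∨ v ∈ computedList xs := by
  simp [computedList]

theorem inCache_final {s : Memory V M} {xs : List (MemAction V M)} {v : V}
    (h : (final s xs).InCache v) :
    s.InCache v ∨ some v ∈ traffic s xs ∨ v ∈ computedList xs := by
  induction xs generalizing s with
  | nil => exact Or.inl h
  | cons x xs ih =>
    simp only [traffic, List.mem_append, mem_computedList_cons]
    have h1 := ih h
    have h2 := fun h => MemAction.inCache_effect (x := x) (s := s) (v := v) h
    tauto

theorem inSlow_final {s : Memory V M} {xs : List (MemAction V M)} {v : V}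
    (h : (final s xs).InSlow v) : s.InSlow v ∨ some v ∈ traffic s xs := by
  induction xs generalizing s with
  | nil => exact Or.inl h
  | cons x xs ih =>
    simp only [traffic, List.mem_append]
    have h1 := ih h
    have h2 := fun h => MemAction.inSlow_effect (x := x) (s := s) (v := v) h
    tauto

/-- Transfers and copies only duplicate values already present, so computing is the only source of a
new value in either memory. -/
theorem inMemory_final {s : Memory V M} {xs : List (MemAction V M)} {v : V}
    (h : (final s xs).InCache v ∨ (final s xs).InSlow v) :
    (s.InCache v ∨ s.InSlow v) ∨ v ∈ computedList xs := by
  induction xs generalizing s with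
  | nil => exact Or.inl h
  | cons x xs ih =>
    rw [mem_computedList_cons]
    have h1 := ih h
    have h2 := fun h => MemAction.inCache_effect (x := x) (s := s) (v := v) h
    have h3 := fun h => MemAction.inSlow_effect (x := x) (s := s) (v := v) h
    have h4 := fun h => MemAction.inMemory_of_mem_words (x := x) (s := s) (v := v) h
    tauto

/-- Just before a vertex is computed, its operands are in the cache. -/
theorem exists_prefix_of_mem_computedList {s : Memory V M} {xs : List (MemAction V M)} {w : V}
    (hl : Legal G B s xs) (h : w ∈ computedList xs) :
    ∃ ys zs, xs = ys ++ zs ∧ w ∈ G.verts ∧ ¬ G.IsInput w ∧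
      ∀ u, G.Adj u w → (final s ys).InCache u := by
  obtain ⟨x, hx, hw⟩ := List.mem_filterMap.1 h
  obtain ⟨ys, zs, rfl⟩ := List.append_of_mem hx
  refine ⟨ys, x :: zs, rfl, ?_⟩
  have h1 := (legal_append.1 hl).2.1
  cases x <;> simp [MemAction.computed] at hw
  subst hw
  exact h1

/-! ### Runs of the machine -/

/-- The machine can go from memory `s` to memory `s'` with at most `q` transfers, computing no
vertex twice and only vertices from `D`. -/
def Run (G : CDAG V) (B : ℕ) (s s' : Memory V M) (q : ℕ) (D : Set V) : Prop :=
  ∃ xs, Legal G B s xs ∧ final s xs = s' ∧ cost xs ≤ q ∧ (computedList xs).Nodup ∧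
    ∀ v ∈ computedList xs, v ∈ D

theorem Run.refl (s : Memory V M) : Run G B s s 0 ∅ :=
  ⟨[], trivial, rfl, le_rfl, List.nodup_nil, by simp [computedList]⟩

theorem Run.mono {s s' : Memory V M} {q q' : ℕ} {D D' : Set V} (h : Run G B s s' q D)
    (hq : q ≤ q') (hD : D ⊆ D') : Run G B s s' q' D' := by
  obtain ⟨xs, h1, h2, h3, h4, h5⟩ := h
  exact ⟨xs, h1, h2, h3.trans hq, h4, fun v hv => hD (h5 v hv)⟩

theorem Run.trans {s s' s'' : Memory V M} {q q' : ℕ} {D D' : Set V} (h : Run G B s s' q D)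
    (h' : Run G B s' s'' q' D') (hD : Disjoint D D') : Run G B s s'' (q + q') (D ∪ D') := by
  obtain ⟨xs, h1, h2, h3, h4, h5⟩ := h
  obtain ⟨ys, k1, k2, k3, k4, k5⟩ := h'
  subst h2
  refine ⟨xs ++ ys, legal_append.2 ⟨h1, k1⟩, by rw [final_append, k2], ?_, ?_, ?_⟩
  · rw [cost_append]; omega
  · rw [computedList_append]
    exact List.nodup_append.2 ⟨h4, k4, fun a ha b hb hab =>
      Set.disjoint_left.1 hD (h5 a ha) (hab ▸ k5 b hb)⟩
  · intro v hv
    rw [computedList_append, List.mem_append] at hv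
    exact hv.imp (h5 v) (k5 v)

theorem Run.transfer_trans {s s' s'' : Memory V M} {q q' : ℕ} {D : Set V}
    (h : Run G B s s' q ∅) (h' : Run G B s' s'' q' D) : Run G B s s'' (q + q') D := by
  simpa using h.trans h' (by simp)

theorem Run.trans_transfer {s s' s'' : Memory V M} {q q' : ℕ} {D : Set V}
    (h : Run G B s s' q D) (h' : Run G B s' s'' q' ∅) : Run G B s s'' (q + q') D := by
  simpa using h.trans h' (by simp)

theorem Run.single_transfer {s : Memory V M} {x : MemAction V M} (h : x.Allowed G B s)
    (hx : x.computed = none) : Run G B s (x.effect s) x.cost ∅ :=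
  ⟨[x], ⟨h, trivial⟩, rfl, by simp [cost], by simp [computedList, hx],
    by simp [computedList, hx]⟩

theorem Run.single_compute {s : Memory V M} {v : V} {p : Fin M}
    (h : (MemAction.compute v p).Allowed G B s) :
    Run G B s ((MemAction.compute v p).effect s) 0 {v} :=
  ⟨[.compute v p], ⟨h, trivial⟩, rfl, by simp [cost, MemAction.cost],
    by simp [computedList, MemAction.computed], by simp [computedList, MemAction.computed]⟩

/-- Loops: `Inv pre` holds when the body has been executed for the members of `pre`. -/
theorem Run.loop {α : Type*} (l : List α) (Inv : List α → Memory V M → Prop) (q : ℕ)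
    (D : α → Set V) (hD : l.Pairwise fun x y => Disjoint (D x) (D y))
    (body : ∀ pre x suf s, l = pre ++ x :: suf → Inv pre s →
      ∃ s', Run G B s s' q (D x) ∧ Inv (pre ++ [x]) s')
    (s : Memory V M) (h0 : Inv [] s) :
    ∃ s', Run G B s s' (l.length * q) {v | ∃ x ∈ l, v ∈ D x} ∧ Inv l s' := by
  suffices H : ∀ suf pre s, l = pre ++ suf → Inv pre s →
      ∃ s', Run G B s s' (suf.length * q) {v | ∃ x ∈ suf, v ∈ D x} ∧ Inv l s' by
    exact H l [] s rfl h0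
  intro suf
  induction suf with
  | nil =>
    intro pre s hl hi
    rw [List.append_nil] at hl
    subst hl
    exact ⟨s, (Run.refl s).mono (Nat.zero_le _) (Set.empty_subset _), hi⟩
  | cons x suf ih =>
    intro pre s hl hi
    obtain ⟨s1, r1, i1⟩ := body pre x suf s hl hi
    obtain ⟨s2, r2, i2⟩ := ih (pre ++ [x]) s1 (by simp [hl]) i1
    refine ⟨s2, (r1.trans r2 ?_).mono ?_ ?_, i2⟩
    · rw [hl, List.pairwise_append] at hD
      have := (List.pairwise_cons.1 hD.2.1).1
      rw [Set.disjoint_left]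
      rintro v hv ⟨y, hy, hvy⟩
      exact Set.disjoint_left.1 (this y hy) hv hvy
    · simp only [List.length_cons]; nlinarith
    · rintro v (hv | ⟨y, hy, hvy⟩)
      · exact ⟨x, by simp, hv⟩
      · exact ⟨y, by simp [hy], hvy⟩

end Schedule

/-! ### Sorted enumerations -/

/-- Supplies every processing order used below: with `f` a rank, the length of a subproblem or the
distance of a tile from the diagonal, whatever an element depends on lies in the prefix before it.
-/
theorem Finset.exists_list_sorted_by {α β : Type*} [LinearOrder β] (F : Finset α) (f : α → β) :
    ∃ l : List α, l.Nodup ∧ (∀ x, x ∈ l ↔ x ∈ F) ∧ l.length = F.card ∧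
      ∀ pre x suf, l = pre ++ x :: suf → ∀ y ∈ F, f y < f x → y ∈ pre := by
  classical
  let r : α → α → Prop := fun x y => f x ≤ f y
  have : Std.Total r := ⟨fun x y => le_total (f x) (f y)⟩
  have : IsTrans α r := ⟨fun x y z => le_trans (a := f x)⟩
  have hp := List.perm_insertionSort r F.toList
  have hm : ∀ x, x ∈ F.toList.insertionSort r ↔ x ∈ F := fun x => by
    rw [hp.mem_iff, Finset.mem_toList]
  refine ⟨F.toList.insertionSort r, hp.nodup_iff.2 F.nodup_toList, hm, ?_, ?_⟩
  · rw [hp.length_eq, Finset.length_toList]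
  · intro pre x suf hl y hy hlt
    have hs := List.pairwise_insertionSort r F.toList
    rw [hl, List.pairwise_append] at hs
    have h1 := (List.pairwise_cons.1 hs.2.1).1
    rw [← hm, hl, List.mem_append, List.mem_cons] at hy
    rcases hy with hy | rfl | hy
    · exact hy
    · exact absurd hlt (lt_irrefl _)
    · exact absurd hlt (not_lt.2 (h1 y hy))

/-! ### Combinatorial tools -/

/-- The discrete Loomis–Whitney inequality in dimension three. -/
theorem Finset.card_sq_le_of_projections {α β γ : Type*} (T : Finset (α × β × γ))
    (A : Finset (α × γ)) (P : Finset (α × β)) (R : Finset (β × γ))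
    (hA : ∀ x ∈ T, (x.1, x.2.2) ∈ A) (hP : ∀ x ∈ T, (x.1, x.2.1) ∈ P)
    (hR : ∀ x ∈ T, (x.2.1, x.2.2) ∈ R) : T.card ^ 2 ≤ A.card * (P.card * R.card) := by
  classical
  let fib : α × γ → Finset (α × β × γ) := fun p => T.filter fun x => (x.1, x.2.2) = p
  have h1 : T.card = ∑ p ∈ A, (fib p).card := Finset.card_eq_sum_card_fiberwise hA
  -- Two triples in the same fibre share their outer coordinates `(i,j)`, so the pair is recovered
  -- from `(i,k) ∈ P` of the first and `(k',j) ∈ R` of the second. Cauchy–Schwarz over the fibres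
  -- then finishes.
  have h2 : ∑ p ∈ A, (fib p).card ^ 2 ≤ P.card * R.card := by
    have : ∑ p ∈ A, (fib p).card ^ 2 = (A.sigma fun p => fib p ×ˢ fib p).card := by
      rw [Finset.card_sigma]
      exact Finset.sum_congr rfl fun p _ => by rw [Finset.card_product, sq]
    rw [this, ← Finset.card_product]
    refine Finset.card_le_card_of_injOn
      (fun z => ((z.2.1.1, z.2.1.2.1), (z.2.2.2.1, z.2.2.2.2))) ?_ ?_
    · rintro ⟨p, x, y⟩ hz
      simp only [Finset.coe_sigma, Set.mem_sigma_iff, Finset.mem_coe, Finset.mem_product,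
        fib, Finset.mem_filter] at hz
      simp only [Finset.mem_coe, Finset.mem_product]
      exact ⟨hP x hz.2.1.1, hR y hz.2.2.1⟩
    · rintro ⟨⟨p1, p2⟩, ⟨x1, x2, x3⟩, ⟨y1, y2, y3⟩⟩ hz ⟨⟨q1, q2⟩, ⟨u1, u2, u3⟩, ⟨v1, v2, v3⟩⟩ hw h
      simp only [Finset.coe_sigma, Set.mem_sigma_iff, Finset.mem_coe, Finset.mem_product,
        fib, Finset.mem_filter, Prod.mk.injEq] at hz hw h
      obtain ⟨-, ⟨-, rfl, rfl⟩, -, rfl, rfl⟩ := hz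
      obtain ⟨-, ⟨-, rfl, rfl⟩, -, rfl, rfl⟩ := hw
      obtain ⟨⟨rfl, rfl⟩, rfl, rfl⟩ := h
      rfl
  rw [h1]
  exact sq_sum_le_card_mul_sum_sq.trans (Nat.mul_le_mul_left _ h2)

/-- A list can be cut into few pieces on which two additive weights are bounded. -/
theorem List.exists_chunks {α : Type*} (f g : α → ℕ) (hf : ∀ x, f x ≤ 1) (hg : ∀ x, g x ≤ 1)
    (Q X : ℕ) (hQ : 1 ≤ Q) (hX : 1 ≤ X) (xs : List α) :
    ∃ cs : List (List α), cs.flatten = xs ∧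
      (∀ c ∈ cs, (c.map f).sum ≤ Q ∧ (c.map g).sum ≤ X) ∧
      Q * X * cs.length ≤ X * (xs.map f).sum + Q * (xs.map g).sum + Q * X := by
  -- Greedy cutting from the right: `c` is the open piece and `cs` are the closed ones. A piece is
  -- closed only when one more element would overflow; as each element weighs at most one, some
  -- weight is then exactly at its cap. So each closed piece contributes at least `Q * X` to the
  -- right-hand side, and the open piece gives the additive `Q * X`.
  suffices H : ∃ (c : List α) (cs : List (List α)), c ++ cs.flatten = xs ∧
      (∀ d ∈ c :: cs, (d.map f).sum ≤ Q ∧ (d.map g).sum ≤ X) ∧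
      Q * X * cs.length ≤ X * (cs.flatten.map f).sum + Q * (cs.flatten.map g).sum by
    obtain ⟨c, cs, h1, h2, h3⟩ := H
    refine ⟨c :: cs, by simp [h1], h2, ?_⟩
    rw [← h1]
    simp only [List.length_cons, List.map_append, List.sum_append]
    have h4 := Nat.zero_le (X * (c.map f).sum)
    have h5 := Nat.zero_le (Q * (c.map g).sum)
    linarith
  induction xs with
  | nil => exact ⟨[], [], by simp, by simp, by simp⟩
  | cons x xs ih =>
    obtain ⟨c, cs, h1, h2, h3⟩ := ih
    have hc := h2 c (by simp)
    have hfx := hf x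
    have hgx := hg x
    by_cases h : (((x :: c).map f).sum ≤ Q ∧ ((x :: c).map g).sum ≤ X)
    · refine ⟨x :: c, cs, by simp [h1], ?_, h3⟩
      intro d hd
      rcases List.mem_cons.1 hd with rfl | hd
      · exact h
      · exact h2 d (by simp [hd])
    · refine ⟨[x], c :: cs, by simp [h1], ?_, ?_⟩
      · intro d hd
        rcases List.mem_cons.1 hd with rfl | hd
        · simp; omega
        · exact h2 d hd
      · simp only [List.map_cons, List.sum_cons] at h
        simp only [List.length_cons, List.flatten_cons, List.map_append, List.sum_append]
        have : Q * X ≤ X * (c.map f).sum + Q * (c.map g).sum := by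
          by_cases h' : (c.map f).sum = Q
          · rw [h', mul_comm Q X]; exact Nat.le_add_right _ _
          · have : (c.map g).sum = X := by omega
            rw [this]; exact Nat.le_add_left _ _
        linarith

/-! ### Structure of the dynamic programming CDAG -/

namespace MCM

open MCMVertex AggTree Schedule Memory

variable {n : ℕ} {T : AggOrder n}

theorem S_of_lt {i j : ℕ} (h : i < j) : S T i j = agg i j (T.tree i j) := by
  unfold S
  rw [if_neg (by omega)]

theorem S_self {i : ℕ} : S T i i = init i := by simp [S]

theorem size_le_of_isSubtree {t : AggTree} : ∀ {U : AggTree}, IsSubtree t U → t.size ≤ U.size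
  | leaf _, h => by cases h; exact le_rfl
  | node a b, h => by
      rcases h with h | h | h
      · rw [h]
      · have := size_le_of_isSubtree h; simp only [size]; omega
      · have := size_le_of_isSubtree h; simp only [size]; omega

/-- An operand of a sum belongs to a strictly shorter subproblem than `(1,n)`, and an operand of a
minimum is a proper subtree, excluded for the whole tree by its size. -/
theorem isOutput_S (hn : 2 ≤ n) : (cdag T).IsOutput (S T 1 n) := by
  refine ⟨isVertex_S T le_rfl (show 1 ≤ n by omega) le_rfl, ?_⟩
  rw [S_of_lt (show 1 < n by omega)]
  intro w hw
  change Operand T _ w at hw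
  generalize hu : agg 1 n (T.tree 1 n) = u at hw
  cases hw with
  | sum_left h =>
    obtain ⟨h1, h2, h3, h4⟩ := h
    unfold S at hu
    split_ifs at hu
    simp only [agg.injEq] at hu
    omega
  | sum_right h =>
    obtain ⟨h1, h2, h3, h4⟩ := h
    unfold S at hu
    split_ifs at hu
    simp only [agg.injEq] at hu
    omega
  | node_left h =>
    cases hu
    have := size_le_of_isSubtree h.2.2.2
    simp only [size] at this
    omega
  | node_right h =>
    cases hu
    have := size_le_of_isSubtree h.2.2.2
    simp only [size] at this
    omega
  | _ => cases hu

/-- The values that are computed while evaluating one of the minima. -/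
def IsPartial : MCMVertex → Prop
  | sum _ _ _ => True
  | agg _ _ _ => True
  | _ => False

/-- The subproblem to which a value belongs. -/
def subproblem : MCMVertex → ℕ × ℕ
  | sum i _ j => (i, j)
  | agg i j _ => (i, j)
  | _ => (0, 0)

/-- The sums and partial minima evaluated for `S(i,j)`. -/
def InGroup (T : AggOrder n) (i j : ℕ) (v : MCMVertex) : Prop :=
  (∃ k, i ≤ k ∧ k < j ∧ v = sum i k j) ∨ ∃ t, IsSubtree t (T.tree i j) ∧ v = agg i j t

theorem InGroup.isPartial {i j : ℕ} {v : MCMVertex} (h : InGroup T i j v) : IsPartial v := by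
  rcases h with ⟨k, -, -, rfl⟩ | ⟨t, -, rfl⟩ <;> trivial

theorem InGroup.subproblem_eq {i j : ℕ} {v : MCMVertex} (h : InGroup T i j v) :
    subproblem v = (i, j) := by
  rcases h with ⟨k, -, -, rfl⟩ | ⟨t, -, rfl⟩ <;> rfl

theorem inGroup_S {i j : ℕ} (h : i < j) : InGroup T i j (S T i j) :=
  Or.inr ⟨_, sub_refl _, S_of_lt h⟩

theorem isSubtree_leaf_of_mem {k : ℕ} : ∀ {U : AggTree}, k ∈ U.leaves → IsSubtree (leaf k) U
  | leaf _, h => by simp [leaves] at h; rw [h]; rfl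
  | node a b, h => by
      simp only [leaves, List.mem_append] at h
      rcases h with h | h
      · exact Or.inr (Or.inl (isSubtree_leaf_of_mem h))
      · exact Or.inr (Or.inr (isSubtree_leaf_of_mem h))

theorem isSubtree_leaf {i j k : ℕ} (hi : 1 ≤ i) (hik : i ≤ k) (hkj : k < j) (hj : j ≤ n) :
    IsSubtree (leaf k) (T.tree i j) := by
  apply isSubtree_leaf_of_mem
  rw [(T.leaves_perm i j hi (by omega) hj).mem_iff, List.mem_range'_1]
  omega

/-- A property that is the same at both ends of every edge inside a group holds for all of the
group if it holds at the root. -/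
theorem iff_root_of_edges {i j : ℕ} (hi : 1 ≤ i) (hij : i < j) (hj : j ≤ n)
    (p : MCMVertex → Prop)
    (hp : ∀ u w, InGroup T i j u → InGroup T i j w → Operand T u w → (p u ↔ p w))
    {v : MCMVertex} (hv : InGroup T i j v) : p v ↔ p (S T i j) := by
  have key : ∀ u t, IsSubtree u (T.tree i j) → IsSubtree t u →
      (p (agg i j t) ↔ p (agg i j u)) := by
    intro u
    induction u with
    | leaf k => intro t _ ht; cases ht; rfl
    | node l r ihl ihr =>
      intro t hu ht
      have hV : IsVertex T (agg i j (node l r)) := ⟨hi, hij, hj, hu⟩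
      have hl := sub_left hu
      have hr := sub_right hu
      rcases ht with rfl | ht | ht
      · rfl
      · rw [ihl t hl ht]
        exact hp _ _ (Or.inr ⟨l, hl, rfl⟩) (Or.inr ⟨_, hu, rfl⟩) (.node_left hV)
      · rw [ihr t hr ht]
        exact hp _ _ (Or.inr ⟨r, hr, rfl⟩) (Or.inr ⟨_, hu, rfl⟩) (.node_right hV)
  rw [S_of_lt hij]
  rcases hv with ⟨k, hik, hkj, rfl⟩ | ⟨t, ht, rfl⟩
  · have hk := isSubtree_leaf (T := T) hi hik hkj hj
    rw [← key _ _ (sub_refl _) hk]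
    exact hp _ _ (Or.inl ⟨k, hik, hkj, rfl⟩) (Or.inr ⟨_, hk, rfl⟩) (.leaf_left ⟨hi, hij, hj, hk⟩)
  · exact key _ _ (sub_refl _) ht

/-- The memory before the first step. -/
def start (n M : ℕ) : Memory MCMVertex M := ⟨fun _ => none, input n⟩

theorem not_inMemory_start {M : ℕ} {v : MCMVertex} (hv : IsPartial v) :
    ¬ ((start n M).InCache v ∨ (start n M).InSlow v) := by
  rintro (⟨r, hr⟩ | ⟨a, ha⟩)
  · simp [start] at hr
  · simp only [start, input] at ha
    split_ifs at ha <;> cases ha <;> exact hv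

variable {M B : ℕ} {xs : List (MemAction MCMVertex M)}

/-- A partial value is absent from the initial memory, so it can be in the cache as an operand only
if it was computed earlier. -/
theorem mem_computedList_of_operand (hl : Legal (cdag T) B (start n M) xs) {u w : MCMVertex}
    (hu : IsPartial u) (hw : w ∈ computedList xs) (h : Operand T u w) : u ∈ computedList xs := by
  obtain ⟨ys, zs, rfl, -, -, h3⟩ := exists_prefix_of_mem_computedList hl hw
  rw [computedList_append, List.mem_append]
  exact Or.inl ((inMemory_final (Or.inl (h3 u h))).resolve_left (not_inMemory_start hu))

/-- All sums and partial minima are computed. -/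
theorem mem_computedList_of_inGroup (hn : 2 ≤ n) (he : Evaluates (cdag T) (input n) B xs)
    {i j : ℕ} (hi : 1 ≤ i) (hij : i < j) (hj : j ≤ n) {v : MCMVertex} (hv : InGroup T i j v) :
    v ∈ computedList xs := by
  have hl : Legal (cdag T) B (start n M) xs := he.legal
  -- Once the root of a group is computed, operands can be followed down the tree to every node and
  -- sum.
  have group : ∀ {i j : ℕ}, 1 ≤ i → i < j → j ≤ n → S T i j ∈ computedList xs →
      ∀ v, InGroup T i j v → v ∈ computedList xs := by
    intro i j hi hij hj hS v hv
    have key : ∀ u t, IsSubtree u (T.tree i j) → IsSubtree t u → agg i j u ∈ computedList xs →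
        agg i j t ∈ computedList xs := by
      intro u
      induction u with
      | leaf k => intro t _ ht hc; cases ht; exact hc
      | node l r ihl ihr =>
        intro t hu ht hc
        have hV : IsVertex T (agg i j (node l r)) := ⟨hi, hij, hj, hu⟩
        rcases ht with rfl | ht | ht
        · exact hc
        · exact ihl t (sub_left hu) ht
            (mem_computedList_of_operand hl trivial hc (.node_left hV))
        · exact ihr t (sub_right hu) ht
            (mem_computedList_of_operand hl trivial hc (.node_right hV))
    rw [S_of_lt hij] at hS
    rcases hv with ⟨k, hik, hkj, rfl⟩ | ⟨t, ht, rfl⟩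
    · have hk := isSubtree_leaf (T := T) hi hik hkj hj
      exact mem_computedList_of_operand hl trivial (key _ _ (sub_refl _) hk hS)
        (.leaf_left ⟨hi, hij, hj, hk⟩)
    · exact key _ _ (sub_refl _) ht hS
  have partial_S : ∀ {i j : ℕ}, i < j → IsPartial (S T i j) := fun h => (inGroup_S h).isPartial
  have h1 : S T 1 n ∈ computedList xs := by
    obtain ⟨a, ha⟩ := he.output _ (isOutput_S hn)
    exact (inMemory_final (Or.inr ⟨a, ha⟩)).resolve_left
      (not_inMemory_start (partial_S (by omega)))
  -- Every subproblem is reached from `S(1,n)` in two steps: `S(1,j)` is an operand of the sum for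
  -- `(1,j,n)`, and `S(i,j)` with `i > 1` is an operand of the sum for `(1,i-1,j)`.
  have h2 : ∀ {j}, 1 < j → j ≤ n → S T 1 j ∈ computedList xs := by
    intro j h hj
    rcases Nat.lt_or_ge j n with hjn | hjn
    · exact mem_computedList_of_operand hl (partial_S h)
        (group le_rfl (by omega) le_rfl h1 (sum 1 j n) (Or.inl ⟨j, by omega, hjn, rfl⟩))
        (.sum_left ⟨by omega, by omega, by omega, by omega⟩)
    · rwa [le_antisymm hj hjn]
  have h3 : S T i j ∈ computedList xs := by
    rcases hi.lt_or_eq with h | h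
    · have hop := Operand.sum_right (T := T) (i := 1) (k := i - 1) (j := j)
        ⟨by omega, by omega, by omega, by omega⟩
      rw [show i - 1 + 1 = i by omega] at hop
      exact mem_computedList_of_operand hl (partial_S hij)
        (group le_rfl (by omega) hj (h2 (by omega) hj) (sum 1 (i - 1) j)
          (Or.inl ⟨i - 1, by omega, by omega, rfl⟩)) hop
    · subst h; exact h2 hij hj
  exact group hi hij hj h3 v hv

end MCM

/-! ### Lower bound: values that cross the boundary of a part of a schedule -/

namespace Schedule

variable {V : Type} {M : ℕ} {G : CDAG V} {B : ℕ}

theorem traffic_append (s : Memory V M) (xs ys : List (MemAction V M)) :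
    traffic s (xs ++ ys) = traffic s xs ++ traffic (final s xs) ys := by
  induction xs generalizing s with
  | nil => simp [traffic, final]
  | cons x xs ih => simp [traffic, final_cons, ih]

/-- The words in the cache at the beginning and at the end of a part of a schedule, and
those transferred in between. -/
def boundary (s : Memory V M) (xs : List (MemAction V M)) : List (Option V) :=
  List.ofFn s.cache ++ traffic s xs ++ List.ofFn (final s xs).cache

theorem length_boundary_le {s : Memory V M} {xs : List (MemAction V M)} (h : Legal G B s xs) :
    (boundary s xs).length ≤ 2 * M + B * cost xs := by
  have := length_traffic_le h
  simp only [boundary, List.length_append, List.length_ofFn]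
  omega

theorem mem_boundary {s : Memory V M} {xs : List (MemAction V M)} {v : V} :
    some v ∈ boundary s xs ↔
      s.InCache v ∨ some v ∈ traffic s xs ∨ (final s xs).InCache v := by
  simp only [boundary, List.mem_append, List.mem_ofFn, Memory.InCache, or_assoc]

/-- Operands of the vertices computed in a part of a schedule are computed in it or cross its
boundary. -/
theorem operand_mem_boundary_or_computed {s : Memory V M} {xs : List (MemAction V M)} {u w : V}
    (hl : Legal G B s xs) (hw : w ∈ computedList xs) (h : G.Adj u w) :
    some u ∈ boundary s xs ∨ u ∈ computedList xs := by
  obtain ⟨ys, zs, rfl, -, -, h3⟩ := exists_prefix_of_mem_computedList hl hw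
  rw [mem_boundary, traffic_append, computedList_append]
  have := inCache_final (h3 u h)
  simp only [List.mem_append]
  tauto

end Schedule

namespace MCM

open MCMVertex AggTree Schedule Memory

variable {n : ℕ} {T : AggOrder n} {M B : ℕ} {pre ch post : List (MemAction MCMVertex M)}

/-- If `u` is computed in `ch`, then `w` cannot come earlier, since `u` would have been computed in
`pre` too. It cannot come later, since `u` would have to survive in the cache, travel through slow
memory or be recomputed. Conversely, an operand of a value computed in `ch` that does not cross the
boundary is itself computed there. This is where the ban on recomputation enters. -/
theorem computed_iff_of_edge (hn : 2 ≤ n)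
    (he : Evaluates (cdag T) (input n) B (pre ++ (ch ++ post)))
    {i j : ℕ} (hi : 1 ≤ i) (hij : i < j) (hj : j ≤ n) {u w : MCMVertex}
    (hu : InGroup T i j u) (hw : InGroup T i j w) (h : Operand T u w)
    (hb : some u ∉ boundary (final (start n M) pre) ch) :
    u ∈ computedList ch ↔ w ∈ computedList ch := by
  have hl : Legal (cdag T) B (start n M) (pre ++ (ch ++ post)) := he.legal
  obtain ⟨hl1, hl2⟩ := legal_append.1 hl
  obtain ⟨hl2, hl3⟩ := legal_append.1 hl2
  have hnd : (computedList (pre ++ (ch ++ post))).Nodup := he.no_recomputation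
  rw [computedList_append, computedList_append] at hnd
  have hd1 : u ∈ computedList pre → u ∈ computedList ch → False := fun h1 h2 =>
    (List.disjoint_of_nodup_append hnd) h1 (List.mem_append_left _ h2)
  have hd2 : u ∈ computedList ch → u ∈ computedList post → False := fun h1 h2 =>
    (List.disjoint_of_nodup_append (List.nodup_append.1 hnd).2.1) h1 h2
  have hpre : (final (start n M) pre).InCache u ∨ (final (start n M) pre).InSlow u →
      u ∈ computedList pre := fun h' =>
    (inMemory_final h').resolve_left (not_inMemory_start hu.isPartial)
  constructor
  · intro huc
    have hwc := mem_computedList_of_inGroup hn he hi hij hj hw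
    rw [computedList_append, computedList_append, List.mem_append, List.mem_append] at hwc
    rcases hwc with hwc | hwc | hwc
    · exact (hd1 (mem_computedList_of_operand hl1 hu.isPartial hwc h) huc).elim
    · exact hwc
    · exfalso
      obtain ⟨ys, zs, rfl, -, -, h3⟩ := exists_prefix_of_mem_computedList hl3 hwc
      rw [mem_boundary] at hb
      rcases inMemory_final (Or.inl (h3 u h)) with (h4 | h4) | h4
      · exact hb (Or.inr (Or.inr h4))
      · rcases inSlow_final h4 with h5 | h5
        · exact hd1 (hpre (Or.inr h5)) huc
        · exact hb (Or.inr (Or.inl h5))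
      · exact hd2 huc (by rw [computedList_append]; exact List.mem_append_left _ h4)
  · intro hwc
    exact (operand_mem_boundary_or_computed hl2 hwc h).resolve_left hb

/-- A subproblem with a value that is computed in a part of the schedule or crosses its boundary
has a value crossing the boundary, or is solved entirely in this part. -/
theorem boundary_or_solved (hn : 2 ≤ n)
    (he : Evaluates (cdag T) (input n) B (pre ++ (ch ++ post)))
    {i j : ℕ} (hi : 1 ≤ i) (hij : i < j) (hj : j ≤ n) {v : MCMVertex} (hv : InGroup T i j v)
    (hc : some v ∈ boundary (final (start n M) pre) ch ∨ v ∈ computedList ch) :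
    (∃ z, some z ∈ boundary (final (start n M) pre) ch ∧ subproblem z = (i, j)) ∨
      ∀ k, i ≤ k → k < j → sum i k j ∈ computedList ch := by
  by_cases hz : ∃ z, InGroup T i j z ∧ some z ∈ boundary (final (start n M) pre) ch
  · obtain ⟨z, hz1, hz2⟩ := hz
    exact Or.inl ⟨z, hz2, hz1.subproblem_eq⟩
  · push Not at hz
    right
    intro k hik hkj
    have hE : ∀ u w, InGroup T i j u → InGroup T i j w → Operand T u w →
        (u ∈ computedList ch ↔ w ∈ computedList ch) := fun u w hu hw h =>
      computed_iff_of_edge hn he hi hij hj hu hw h (hz u hu)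
    have h1 := iff_root_of_edges (T := T) hi hij hj (· ∈ computedList ch) hE hv
    have h2 := iff_root_of_edges (T := T) hi hij hj (· ∈ computedList ch) hE
      (Or.inl ⟨k, hik, hkj, rfl⟩)
    exact h2.2 (h1.1 (hc.resolve_left (hz v hv)))

/-- Is the value a sum `S(i,k) + S(k+1,j)`? -/
def isSum : MCMVertex → Bool
  | sum _ _ _ => true
  | _ => false

open Classical in
/-- The long subproblems with a value that crosses the boundary or is computed. -/
noncomputable def touched (T : AggOrder n) (L : ℕ) (s : Memory MCMVertex M)
    (ch : List (MemAction MCMVertex M)) : Finset (ℕ × ℕ) :=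
  (Finset.range (n + 1) ×ˢ Finset.range (n + 1)).filter fun p =>
    1 ≤ p.1 ∧ p.1 + L ≤ p.2 ∧
      ∃ v, InGroup T p.1 p.2 v ∧ (some v ∈ boundary s ch ∨ v ∈ computedList ch)

/-- Each touched subproblem either owns a boundary word, and different subproblems own different
words, or is solved inside the part and consumes at least `L` of the at most `X` sums. The two terms
bound these two kinds. -/
theorem card_touched_le (hn : 2 ≤ n)
    (he : Evaluates (cdag T) (input n) B (pre ++ (ch ++ post))) {L X A : ℕ} (hL : 1 ≤ L)
    (hX : (computedList ch).countP isSum ≤ X) (hA : X ≤ L * A) :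
    (touched T L (final (start n M) pre) ch).card ≤ 2 * M + B * cost ch + A := by
  classical
  set s := final (start n M) pre with hs
  have hl : Legal (cdag T) B s ch :=
    (legal_append.1 (legal_append.1 (show Legal (cdag T) B (start n M) _ from he.legal)).2).1
  let F : Finset (ℕ × ℕ) := (touched T L s ch).filter fun p =>
    ∀ k, p.1 ≤ k → k < p.2 → sum p.1 k p.2 ∈ computedList ch
  let Z : Finset (ℕ × ℕ) := (boundary s ch).reduceOption.toFinset.image subproblem
  have h1 : touched T L s ch ⊆ Z ∪ F := by
    intro p hp
    have hp' := hp
    simp only [touched, Finset.mem_filter, Finset.mem_product, Finset.mem_range] at hp'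
    obtain ⟨⟨-, h2⟩, h3, h4, v, hv, hc⟩ := hp'
    rw [Finset.mem_union]
    rcases boundary_or_solved hn he h3 (by omega) (by omega) hv hc with ⟨z, hz, hzp⟩ | h
    · left
      simp only [Z, Finset.mem_image, List.mem_toFinset, List.reduceOption_mem_iff]
      exact ⟨z, hz, hzp⟩
    · right
      exact Finset.mem_filter.2 ⟨hp, h⟩
  have hZ : Z.card ≤ 2 * M + B * cost ch :=
    Finset.card_image_le.trans ((List.toFinset_card_le _).trans
      ((List.reduceOption_length_le _).trans (length_boundary_le hl)))
  -- Charge to each solved subproblem its first `L` sums, with split positions `i, …, i + L - 1`;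
  -- these exist because `i + L ≤ j`.
  have hF : F.card * L ≤ X := by
    refine le_trans ?_ hX
    rw [List.countP_eq_length_filter, ← Finset.card_range L, ← Finset.card_product]
    refine le_trans ?_ (List.toFinset_card_le _)
    refine Finset.card_le_card_of_injOn (fun x => sum x.1.1 (x.1.1 + x.2) x.1.2) ?_ ?_
    · rintro ⟨p, x⟩ hx
      simp only [Finset.coe_product, Set.mem_prod, Finset.mem_coe, F, Finset.mem_filter,
        touched, Finset.mem_range] at hx
      simp only [Finset.mem_coe, List.mem_toFinset, List.mem_filter]
      exact ⟨hx.1.2 _ (by omega) (by omega), rfl⟩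
    · rintro ⟨⟨p, q⟩, x⟩ - ⟨⟨p', q'⟩, x'⟩ - h
      simp only [sum.injEq] at h
      obtain ⟨rfl, h, rfl⟩ := h
      rw [Nat.add_left_cancel h]
  have hF' : F.card ≤ A := by
    by_contra hlt
    push Not at hlt
    nlinarith
  calc _ ≤ (Z ∪ F).card := Finset.card_le_card h1
    _ ≤ Z.card + F.card := Finset.card_union_le _ _
    _ ≤ _ := by omega

/-- Split positions of widely separated triples. -/
def box (L : ℕ) : Finset (ℕ × ℕ × ℕ) :=
  Finset.Ico 1 (L + 1) ×ˢ Finset.Ico (2 * L) (3 * L) ×ˢ Finset.Ico (4 * L) (5 * L)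

theorem card_box (L : ℕ) : (box L).card = L ^ 3 := by
  simp only [box, Finset.card_product, Nat.card_Ico]
  rw [show L + 1 - 1 = L by omega, show 3 * L - 2 * L = L by omega,
    show 5 * L - 4 * L = L by omega]
  ring

open Classical in
/-- The widely separated triples whose sum is computed in a part of the schedule. -/
noncomputable def boxPart (L : ℕ) (ch : List (MemAction MCMVertex M)) : Finset (ℕ × ℕ × ℕ) :=
  (box L).filter fun x => sum x.1 x.2.1 x.2.2 ∈ computedList ch

/-- Loomis–Whitney, with all three projections landing among the touched subproblems: `(i,j)` owns
the computed sum, while `S(i,k)` and `S(k+1,j)` are its operands and so are computed in the part or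
cross its boundary. -/
theorem card_boxPart_sq_le (hn : 2 ≤ n)
    (he : Evaluates (cdag T) (input n) B (pre ++ (ch ++ post))) {L X A : ℕ} (hL : 2 ≤ L)
    (hLn : 5 * L ≤ n)
    (hX : (computedList ch).countP isSum ≤ X) (hA : X ≤ (L - 1) * A) :
    (boxPart L ch).card ^ 2 ≤ (2 * M + B * cost ch + A) ^ 3 := by
  classical
  have hc := card_touched_le hn he (L := L - 1) (by omega) hX hA
  set s := final (start n M) pre with hs
  set U := touched T (L - 1) s ch with hU
  have hl : Legal (cdag T) B s ch :=
    (legal_append.1 (legal_append.1 (show Legal (cdag T) B (start n M) _ from he.legal)).2).1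
  have hmem : ∀ {i j v}, 1 ≤ i → i + (L - 1) ≤ j → j ≤ n → InGroup T i j v →
      (some v ∈ boundary s ch ∨ v ∈ computedList ch) → (i, j) ∈ U := by
    intro i j v h1 h2 h3 h4 h5
    simp only [hU, touched, Finset.mem_filter, Finset.mem_product, Finset.mem_range]
    exact ⟨⟨by omega, by omega⟩, h1, h2, v, h4, h5⟩
  have hx : ∀ x ∈ boxPart L ch, (1 ≤ x.1 ∧ x.1 ≤ L) ∧ (2 * L ≤ x.2.1 ∧ x.2.1 < 3 * L) ∧
      (4 * L ≤ x.2.2 ∧ x.2.2 < 5 * L) ∧ sum x.1 x.2.1 x.2.2 ∈ computedList ch := by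
    intro x hx
    simp only [boxPart, box, Finset.mem_filter, Finset.mem_product, Finset.mem_Ico] at hx
    exact ⟨⟨hx.1.1.1, by omega⟩, hx.1.2.1, hx.1.2.2, hx.2⟩
  -- The right operand is indexed by `k + 1`; shifting its first index back by one makes it a
  -- projection of `(i,k,j)`.
  have hR : (U.image fun p => (p.1 - 1, p.2)).card ≤ U.card := Finset.card_image_le
  have h := Finset.card_sq_le_of_projections (boxPart L ch) U U
    (U.image fun p => (p.1 - 1, p.2)) ?_ ?_ ?_
  · calc (boxPart L ch).card ^ 2 ≤ _ := h
      _ ≤ U.card * (U.card * U.card) := by gcongr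
      _ = U.card ^ 3 := by ring
      _ ≤ _ := Nat.pow_le_pow_left hc 3
  · rintro ⟨i, k, j⟩ hmemx
    obtain ⟨h1, h2, h3, h4⟩ := hx _ hmemx
    simp only at h1 h2 h3 h4 ⊢
    exact hmem h1.1 (by omega) (by omega) (Or.inl ⟨k, by omega, by omega, rfl⟩) (Or.inr h4)
  · rintro ⟨i, k, j⟩ hmemx
    obtain ⟨h1, h2, h3, h4⟩ := hx _ hmemx
    simp only at h1 h2 h3 h4 ⊢
    exact hmem h1.1 (by omega) (by omega) (inGroup_S (by omega))
      (operand_mem_boundary_or_computed hl h4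
        (.sum_left ⟨by omega, by omega, by omega, by omega⟩))
  · rintro ⟨i, k, j⟩ hmemx
    obtain ⟨h1, h2, h3, h4⟩ := hx _ hmemx
    simp only at h1 h2 h3 h4 ⊢
    exact Finset.mem_image.2 ⟨(k + 1, j), hmem (by omega) (by omega) (by omega)
      (inGroup_S (by omega)) (operand_mem_boundary_or_computed hl h4
        (.sum_right ⟨by omega, by omega, by omega, by omega⟩)), rfl⟩

theorem isVertex_of_mem_computedList {s : Memory MCMVertex M} {xs : List (MemAction MCMVertex M)}
    (hl : Legal (cdag T) B s xs) {v : MCMVertex} (hv : v ∈ computedList xs) : IsVertex T v := by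
  obtain ⟨ys, zs, -, h, -, -⟩ := exists_prefix_of_mem_computedList hl hv
  exact h

theorem countP_isSum_le {xs : List (MemAction MCMVertex M)}
    (he : Evaluates (cdag T) (input n) B xs) : (computedList xs).countP isSum ≤ n ^ 3 := by
  classical
  have hnd : (computedList xs).Nodup := he.no_recomputation
  rw [List.countP_eq_length_filter, ← List.toFinset_card_of_nodup (hnd.filter _)]
  have : ((computedList xs).filter isSum).toFinset ⊆
      (Finset.Ico 1 (n + 1) ×ˢ Finset.Ico 1 (n + 1) ×ˢ Finset.Ico 1 (n + 1)).image
        fun x => sum x.1 x.2.1 x.2.2 := by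
    intro v hv
    simp only [List.mem_toFinset, List.mem_filter] at hv
    have hV := isVertex_of_mem_computedList he.legal hv.1
    cases v with
    | sum i k j =>
      obtain ⟨h1, h2, h3, h4⟩ := hV
      refine Finset.mem_image.2 ⟨(i, k, j), ?_, rfl⟩
      simp only [Finset.mem_product, Finset.mem_Ico]
      omega
    | _ => simp [isSum] at hv
  refine (Finset.card_le_card this).trans (Finset.card_image_le.trans ?_)
  simp only [Finset.card_product, Nat.card_Ico, Nat.add_sub_cancel]
  exact le_of_eq (by ring)

/-- The lower bound in terms of free parameters. -/
theorem box_le_of_evaluates (hn : 2 ≤ n) {xs : List (MemAction MCMVertex M)}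
    (he : Evaluates (cdag T) (input n) B xs) {L X A Q Y : ℕ} (hL : 2 ≤ L)
    (hLn : 5 * L ≤ n) (hA : X ≤ (L - 1) * A) (hQ : 1 ≤ Q) (hX : 1 ≤ X)
    (hY : (2 * M + B * Q + A) ^ 3 ≤ Y ^ 2) :
    Q * X * L ^ 3 ≤ (X * cost xs + Q * n ^ 3 + Q * X) * Y := by
  classical
  -- The two weights of an action are its transfer cost and whether it computes a sum.
  obtain ⟨cs, hcs, h1, h2⟩ := List.exists_chunks (α := MemAction MCMVertex M) MemAction.cost
    (fun x => (computedList [x]).countP isSum) (fun x => by cases x <;> simp [MemAction.cost])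
    (fun x => List.countP_le_length.trans (List.length_filterMap_le _ [x])) Q X hQ hX xs
  have hsum : ∀ ys : List (MemAction MCMVertex M),
      (ys.map fun x => (computedList [x]).countP isSum).sum = (computedList ys).countP isSum := by
    intro ys
    induction ys with
    | nil => rfl
    | cons y ys ih =>
      rw [List.map_cons, List.sum_cons, ih, ← List.countP_append, ← computedList_append]
      rfl
  have hch : ∀ c ∈ cs, (boxPart L c).card ≤ Y := by
    intro c hc
    obtain ⟨p, q, hpq⟩ := List.append_of_mem hc
    have hxs : xs = p.flatten ++ (c ++ q.flatten) := by rw [← hcs, hpq]; simp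
    obtain ⟨h3, h4⟩ := h1 c hc
    rw [hsum] at h4
    rw [hxs] at he
    have h5 := card_boxPart_sq_le hn he hL hLn h4 hA
    have h6 : cost c ≤ Q := h3
    refine (Nat.pow_le_pow_iff_left (two_ne_zero)).1 (h5.trans (le_trans ?_ hY))
    gcongr
  -- Every sum of the box is computed somewhere, so the parts cover the box.
  have hcover : box L ⊆ cs.toFinset.biUnion (boxPart L) := by
    rintro ⟨i, k, j⟩ hx
    have hx' := hx
    simp only [box, Finset.mem_product, Finset.mem_Ico] at hx'
    have := mem_computedList_of_inGroup hn he (i := i) (j := j) (by omega) (by omega) (by omega)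
      (Or.inl ⟨k, by omega, by omega, rfl⟩)
    rw [← hcs] at this
    obtain ⟨a, ha, hav⟩ := List.mem_filterMap.1 this
    obtain ⟨c, hc, hac⟩ := List.mem_flatten.1 ha
    simp only [Finset.mem_biUnion, List.mem_toFinset]
    exact ⟨c, hc, Finset.mem_filter.2 ⟨hx, List.mem_filterMap.2 ⟨a, hac, hav⟩⟩⟩
  have h3 : L ^ 3 ≤ cs.length * Y := by
    rw [← card_box]
    refine (Finset.card_le_card hcover).trans ((Finset.card_biUnion_le_card_mul _ _ Y ?_).trans ?_)
    · intro c hc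
      exact hch c (List.mem_toFinset.1 hc)
    · exact Nat.mul_le_mul_right _ (List.toFinset_card_le _)
  have h4 := countP_isSum_le he
  rw [hsum] at h2
  have h2' : Q * X * cs.length ≤ X * cost xs + Q * n ^ 3 + Q * X := by
    refine h2.trans ?_
    unfold cost
    gcongr
  calc Q * X * L ^ 3 ≤ Q * X * (cs.length * Y) := by gcongr
    _ = Q * X * cs.length * Y := by ring
    _ ≤ _ := by gcongr

end MCM

/-! ### Lower bound: choice of the parameters -/

namespace MCM

open Schedule

/-- The lower bound. -/
theorem le_of_mem_transferCounts {n M B q : ℕ} (hB : 1 ≤ B) (hBM : B ≤ M)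
    (hM : Real.sqrt M * 10 ^ 7 ≤ n) (hq : q ∈ transferCounts n M B) :
    1 / 256000 * ((n : ℝ) ^ 3 / ((B : ℝ) * Real.sqrt (M : ℝ))) ≤ (q : ℝ) := by
  obtain ⟨T, xs, he, rfl⟩ := hq
  set r := Real.sqrt M with hr
  have hr2 : r ^ 2 = M := Real.sq_sqrt (Nat.cast_nonneg M)
  have hr1 : 1 ≤ r := by
    rw [hr, Real.one_le_sqrt]
    exact_mod_cast hB.trans hBM
  have hn : 10 ^ 7 ≤ n := by
    have : ((10 ^ 7 : ℕ) : ℝ) ≤ n := by push_cast; nlinarith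
    exact_mod_cast this
  -- `m` is an integer substitute for `√M`, with `√M ≤ m ≤ 2√M`.
  obtain ⟨m, hm⟩ : ∃ m, m = Nat.sqrt M + 1 := ⟨_, rfl⟩
  have hm1 : M ≤ m ^ 2 := by
    have := Nat.lt_succ_sqrt M
    rw [hm, sq]; exact this.le
  have hm2 : (m : ℝ) ≤ 2 * r := by
    have := Real.nat_sqrt_le_real_sqrt (a := M)
    rw [hm]; push_cast; linarith
  have hm3 : (m : ℝ) ^ 3 ≤ 8 * (M * r) := by
    calc (m : ℝ) ^ 3 ≤ (2 * r) ^ 3 := by gcongr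
      _ = 8 * (r ^ 2 * r) := by ring
      _ = _ := by rw [hr2]
  have hQ : 1 ≤ M / B := Nat.div_pos hBM hB
  have hBQ : B * (M / B) ≤ M := Nat.mul_div_le M B
  have hL1 : (n : ℝ) / 10 ≤ ((n / 5 - 1 : ℕ) : ℝ) := by
    have : n ≤ 10 * (n / 5 - 1) := by omega
    have : (n : ℝ) ≤ 10 * ((n / 5 - 1 : ℕ) : ℝ) := by exact_mod_cast this
    linarith
  have hL2 : (n : ℝ) / 10 ≤ ((n / 5 : ℕ) : ℝ) :=
    hL1.trans (by exact_mod_cast Nat.sub_le _ _)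
  have hMr : (0 : ℝ) ≤ M * r := by positivity
  -- The cap `X = 32000 m³` allows at most `M` long subproblems solved in one part. This uses that
  -- `n` exceeds a large multiple of `√M`.
  have hA : 32000 * m ^ 3 ≤ (n / 5 - 1) * M := by
    have h1 : (32000 : ℝ) * (m : ℝ) ^ 3 ≤ ((n / 5 - 1 : ℕ) : ℝ) * M := by
      calc (32000 : ℝ) * (m : ℝ) ^ 3 ≤ 32000 * (8 * (M * r)) := by gcongr
        _ = (256000 * r) * M := by ring
        _ ≤ _ := by gcongr; linarith
    exact_mod_cast h1
  -- At most `4M ≤ 4m²` subproblems are touched, so a part covers at most `(4m²)^{3/2} = 8m³`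
  -- triples of the box.
  have hY : (2 * M + B * (M / B) + M) ^ 3 ≤ (8 * m ^ 3) ^ 2 := by
    calc (2 * M + B * (M / B) + M) ^ 3 ≤ (4 * m ^ 2) ^ 3 := by
          apply Nat.pow_le_pow_left; omega
      _ = _ := by ring
  have hmpos : 0 < m := by omega
  have key := box_le_of_evaluates (by omega) he (L := n / 5) (X := 32000 * m ^ 3) (A := M)
    (Q := M / B) (Y := 8 * m ^ 3) (by omega) (by omega) hA hQ
    (Nat.one_le_iff_ne_zero.2 (by positivity)) hY
  obtain ⟨Q, hQd⟩ : ∃ Q, Q = M / B := ⟨_, rfl⟩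
  rw [← hQd] at key hQ hBQ
  have hQB : M ≤ 2 * (Q * B) := by
    have := Nat.lt_mul_div_succ M (show 0 < B by omega)
    rw [← hQd] at this
    nlinarith
  have hQB' : (M : ℝ) ≤ 2 * ((Q : ℝ) * B) := by exact_mod_cast hQB
  have key' : ((Q : ℝ) * (32000 * (m : ℝ) ^ 3)) * ((n / 5 : ℕ) : ℝ) ^ 3 ≤
      (32000 * (m : ℝ) ^ 3 * (cost xs : ℝ) + Q * (n : ℝ) ^ 3 + Q * (32000 * (m : ℝ) ^ 3)) *
        (8 * (m : ℝ) ^ 3) := by exact_mod_cast key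
  have hm0 : (0 : ℝ) < (m : ℝ) ^ 3 := by positivity
  have k1 : (Q : ℝ) * 32000 * ((n / 5 : ℕ) : ℝ) ^ 3 ≤
      8 * (32000 * (m : ℝ) ^ 3 * (cost xs : ℝ) + Q * (n : ℝ) ^ 3 + Q * (32000 * (m : ℝ) ^ 3)) := by
    refine le_of_mul_le_mul_right ?_ hm0
    calc _ = ((Q : ℝ) * (32000 * (m : ℝ) ^ 3)) * ((n / 5 : ℕ) : ℝ) ^ 3 := by ring
      _ ≤ _ := key'
      _ = _ := by ring
  have k2 : (Q : ℝ) * 32 * (n : ℝ) ^ 3 ≤ (Q : ℝ) * 32000 * ((n / 5 : ℕ) : ℝ) ^ 3 := by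
    calc (Q : ℝ) * 32 * (n : ℝ) ^ 3 = (Q : ℝ) * 32000 * ((n : ℝ) / 10) ^ 3 := by ring
      _ ≤ _ := by gcongr
  have k3 : (m : ℝ) ^ 3 ≤ (n : ℝ) ^ 3 / 32000 := by
    calc (m : ℝ) ^ 3 ≤ (2 * ((n : ℝ) / 10 ^ 7)) ^ 3 := by
          gcongr
          refine hm2.trans ?_
          have : r ≤ (n : ℝ) / 10 ^ 7 := by rw [le_div_iff₀ (by positivity)]; exact hM
          linarith
      _ = (n : ℝ) ^ 3 * (8 / 10 ^ 21) := by ring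
      _ ≤ (n : ℝ) ^ 3 * (1 / 32000) := mul_le_mul_of_nonneg_left (by norm_num) (by positivity)
      _ = _ := by ring
  have k4 : (Q : ℝ) * (m : ℝ) ^ 3 ≤ Q * ((n : ℝ) ^ 3 / 32000) := by gcongr
  -- The box contributes `32 Q n³` on the left of `k1`. The terms for the sum cap and for the one
  -- extra part take at most `8 Q n³` each on the right, leaving `16 Q n³ ≤ 256000 m³ · cost`.
  have k5 : (Q : ℝ) * (n : ℝ) ^ 3 ≤ 16000 * ((m : ℝ) ^ 3 * (cost xs : ℝ)) := by
    linarith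
  have k6 : (m : ℝ) ^ 3 * (cost xs : ℝ) ≤ 8 * (M * r) * (cost xs : ℝ) := by gcongr
  have hB0 : (0 : ℝ) < B := by exact_mod_cast hB
  have hr0 : 0 < r := by linarith
  have hM0 : (0 : ℝ) < M := by rw [← hr2]; positivity
  rw [mul_div_assoc', div_le_iff₀ (by positivity)]
  refine le_of_mul_le_mul_right ?_ hM0
  calc 1 / 256000 * (n : ℝ) ^ 3 * M ≤ 1 / 256000 * (n : ℝ) ^ 3 * (2 * (Q * B)) := by gcongr
    _ = 1 / 128000 * B * (Q * (n : ℝ) ^ 3) := by ring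
    _ ≤ 1 / 128000 * B * (16000 * (8 * (M * r) * (cost xs : ℝ))) :=
        mul_le_mul_of_nonneg_left (by linarith) (by positivity)
    _ = _ := by ring

end MCM

/-! ### Upper bound for tiny caches: one vertex at a time -/

namespace Schedule

variable {V : Type} {M : ℕ} {G : CDAG V} {B : ℕ}

/-- Evaluating vertex by vertex: two reads and one write for each of them. -/
theorem exists_evaluates_of_binary {β : Type*} [LinearOrder β] (G : CDAG V)
    (input : ℕ → Option V) (hM : 2 ≤ M) (hB : 1 ≤ B) (F : Finset V)
    (hF : ∀ v, v ∈ F ↔ v ∈ G.verts ∧ ¬ G.IsInput v) (rank : V → β)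
    (hrank : ∀ u v, G.Adj u v → rank u < rank v) (op₁ op₂ : V → V)
    (hop : ∀ u v, G.Adj u v → u = op₁ v ∨ u = op₂ v) (base : ℕ) (inAddr : V → ℕ)
    (hin : ∀ v, G.IsInput v → inAddr v < base ∧ input (inAddr v) = some v) :
    ∃ xs : List (MemAction V M), Evaluates G input B xs ∧ cost xs ≤ F.card * 3 := by
  classical
  obtain ⟨l, hnd, hmem, hlen, hsort⟩ := F.exists_list_sorted_by rank
  -- Inputs keep their addresses below `base`; the `m`-th computed vertex, counting from zero, gets
  -- the private address `base + m`, so no stored value is overwritten.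
  let addr : V → ℕ := fun v => if v ∈ l then base + l.idxOf v else inAddr v
  have hinl : ∀ v, G.IsInput v → v ∉ l := fun v hv h => ((hF v).1 ((hmem v).1 h)).2 hv
  have haddr : ∀ u v, v ∈ l → (G.IsInput u ∨ u ∈ l) → addr u = addr v → u = v := by
    intro u v hv hu h
    by_cases hul : u ∈ l
    · simp only [addr, hul, hv, if_true] at h
      exact (List.idxOf_inj hul).1 (Nat.add_left_cancel h)
    · have := (hin u (hu.resolve_right hul)).1
      simp only [addr, hul, hv, if_true, if_false] at h
      omega
  let Inv : List V → Memory V M → Prop := fun pre s =>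
    ∀ u, G.IsInput u ∨ u ∈ pre → s.slow (addr u) = some u
  have h0 : Inv [] ⟨fun _ => none, input⟩ := by
    intro u hu
    have hu' : G.IsInput u := hu.resolve_right (by simp)
    simp only [addr, hinl u hu', if_false]
    exact (hin u hu').2
  obtain ⟨s', ⟨xs, h1, h2, h3, h4, -⟩, h6⟩ := Run.loop (G := G) (B := B) l Inv 3 (fun v => {v})
    (hnd.imp fun h => by simpa using h) (by
      intro pre v suf s hl hi
      have hvl : v ∈ l := by simp [hl]
      have hvF := (hF v).1 ((hmem v).1 hvl)
      let c0 : Fin M := ⟨0, by omega⟩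
      let c1 : Fin M := ⟨1, by omega⟩
      have r1 := Run.single_transfer (G := G) (B := B) (s := s)
        (x := .read (addr (op₁ v)) 0 1) ⟨hB, by omega⟩ rfl
      set s1 := (MemAction.read (M := M) (addr (op₁ v)) 0 1).effect s with hs1
      have r2 := Run.single_transfer (G := G) (B := B) (s := s1)
        (x := .read (addr (op₂ v)) 1 1) ⟨hB, by omega⟩ rfl
      set s2 := (MemAction.read (M := M) (addr (op₂ v)) 1 1).effect s1 with hs2
      have e0 : s2.cache c0 = s.slow (addr (op₁ v)) := by
        simp [hs2, hs1, MemAction.effect, c0]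
      have e1 : s2.cache c1 = s.slow (addr (op₂ v)) := by
        simp [hs2, hs1, MemAction.effect, c1]
      have r3 := Run.single_compute (G := G) (B := B) (s := s2) (v := v) (p := c0) (by
        refine ⟨hvF.1, hvF.2, fun u hu => ?_⟩
        have hus : s.slow (addr u) = some u := by
          apply hi
          by_cases hui : G.IsInput u
          · exact Or.inl hui
          · exact Or.inr (hsort pre v suf hl u ((hF u).2 ⟨G.left_mem hu, hui⟩) (hrank u v hu))
        rcases hop u v hu with h | h
        · exact ⟨c0, by rw [e0, ← h, hus]⟩
        · exact ⟨c1, by rw [e1, ← h, hus]⟩)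
      set s3 := (MemAction.compute v c0).effect s2 with hs3
      have r4 := Run.single_transfer (G := G) (B := B) (s := s3)
        (x := .write 0 (addr v) 1) ⟨hB, by omega⟩ rfl
      refine ⟨_, ((r1.transfer_trans r2).transfer_trans (r3.trans_transfer r4)).mono ?_ subset_rfl,
        ?_⟩
      · simp [MemAction.cost]
      · intro u hu
        simp only [MemAction.effect]
        by_cases huv : u = v
        · subst huv
          have : 0 < M := by omega
          simp [this, hs3, MemAction.effect, c0]
        · have hu' : G.IsInput u ∨ u ∈ pre := by
            simpa [huv] using hu
          have hne : addr u ≠ addr v := fun h => huv (haddr u v hvl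
            (hu'.imp_right fun h => by simp [hl, h]) h)
          rw [if_neg (by omega)]
          exact hi u hu')
    _ h0
  refine ⟨xs, ⟨h1, h4, fun v hv => ⟨addr v, ?_⟩⟩, by rw [← hlen]; exact h3⟩
  rw [h2]
  apply h6
  by_cases hvi : G.IsInput v
  · exact Or.inl hvi
  · exact Or.inr ((hmem v).2 ((hF v).2 ⟨hv.1, hvi⟩))

end Schedule

/-! ### Comb-shaped aggregation trees and the count of computed vertices -/

namespace AggTree

/-- The left comb with the given leaves. -/
def comb : List ℕ → AggTree
  | [] => leaf 0
  | k :: ks => ks.foldl (fun t x => node t (leaf x)) (leaf k)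

theorem comb_append_singleton {l : List ℕ} (hl : l ≠ []) (k : ℕ) :
    comb (l ++ [k]) = node (comb l) (leaf k) := by
  cases l with
  | nil => exact absurd rfl hl
  | cons a l => simp [comb]

theorem leaves_comb {l : List ℕ} (hl : l ≠ []) : (comb l).leaves = l := by
  induction l using List.reverseRecOn with
  | nil => exact absurd rfl hl
  | append_singleton l k ih =>
    rcases eq_or_ne l [] with rfl | h
    · rfl
    · rw [comb_append_singleton h]
      simp [leaves, ih h]

/-- Combs grow at the root, so the running minimum over any nonempty initial segment of the list is
itself a vertex of the CDAG. -/
theorem isSubtree_comb {l m : List ℕ} (hl : l ≠ []) : IsSubtree (comb l) (comb (l ++ m)) := by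
  induction m using List.reverseRecOn with
  | nil => rw [List.append_nil]; exact sub_refl _
  | append_singleton m k ih =>
    rw [← List.append_assoc, comb_append_singleton (by simp [hl])]
    exact Or.inr (Or.inl ih)

/-- The subtrees below the nodes of a tree. -/
def subtrees : AggTree → List AggTree
  | leaf k => [leaf k]
  | node l r => node l r :: (l.subtrees ++ r.subtrees)

theorem mem_subtrees {t : AggTree} : ∀ {U : AggTree}, t ∈ U.subtrees ↔ IsSubtree t U
  | leaf _ => by simp [subtrees, IsSubtree]
  | node l r => by simp [subtrees, IsSubtree, mem_subtrees]

theorem length_subtrees : ∀ U : AggTree, U.subtrees.length + 1 = 2 * U.leaves.length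
  | leaf _ => rfl
  | node l r => by
      have := length_subtrees l
      have := length_subtrees r
      simp only [subtrees, leaves, List.length_cons, List.length_append]
      omega

end AggTree

/-- The aggregation order given by left combs. -/
def AggOrder.ofLists (n : ℕ) (ord : ℕ → ℕ → List ℕ)
    (h : ∀ i j, 1 ≤ i → i < j → j ≤ n → (ord i j).Perm (List.range' i (j - i))) :
    AggOrder n where
  tree i j := AggTree.comb (ord i j)
  leaves_perm i j h1 h2 h3 := by
    have hp := h i j h1 h2 h3
    rw [AggTree.leaves_comb]
    · exact hp
    · intro h0
      have := hp.length_eq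
      rw [h0, List.length_range'] at this
      simp at this
      omega

namespace MCM

open MCMVertex AggTree Schedule

variable {n : ℕ}

theorem not_isInput {T : AggOrder n} {u v : MCMVertex} (h : Operand T u v) :
    ¬ (cdag T).IsInput v := fun h' => h'.2 u h

/-- The vertices `S(i,i)` and `d_m`. -/
def IsGiven : MCMVertex → Prop
  | dim _ => True
  | init _ => True
  | _ => False

theorem isInput_iff {T : AggOrder n} {v : MCMVertex} :
    (cdag T).IsInput v ↔ IsVertex T v ∧ IsGiven v := by
  constructor
  · intro h
    refine ⟨h.1, ?_⟩
    have hV : IsVertex T v := h.1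
    cases v with
    | dim m => trivial
    | init i => trivial
    | dd i k j => exact not_isInput (.dd_left hV) h
    | ddd i k j => exact not_isInput (.ddd_left hV) h
    | sum i k j => exact not_isInput (.sum_left hV) h
    | agg i j t =>
      cases t with
      | leaf k => exact not_isInput (.leaf_left hV) h
      | node l r => exact not_isInput (.node_left hV) h
  · rintro ⟨h1, h2⟩
    refine ⟨h1, fun u hu => ?_⟩
    change Operand T u v at hu
    cases hu <;> exact h2

/-- The first operand. -/
def leftOperand (T : AggOrder n) : MCMVertex → MCMVertex
  | dd i _ _ => dim (i - 1)
  | ddd i k j => dd i k j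
  | sum i k _ => S T i k
  | agg i j (leaf k) => sum i k j
  | agg i j (node l _) => agg i j l
  | v => v

/-- The second operand. -/
def rightOperand (T : AggOrder n) : MCMVertex → MCMVertex
  | dd _ k _ => dim k
  | ddd _ _ j => dim j
  | sum _ k j => S T (k + 1) j
  | agg i j (leaf k) => ddd i k j
  | agg i j (node _ r) => agg i j r
  | v => v

theorem eq_operand {T : AggOrder n} {u v : MCMVertex} (h : Operand T u v) :
    u = leftOperand T v ∨ u = rightOperand T v := by
  cases h <;> first | exact Or.inl rfl | exact Or.inr rfl

/-- The initial address of a given value. -/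
def inputAddress (n : ℕ) : MCMVertex → ℕ
  | dim m => m
  | init i => n + i
  | _ => 0

theorem input_inputAddress {T : AggOrder n} {v : MCMVertex} (hv : IsVertex T v)
    (hg : IsGiven v) : inputAddress n v < 2 * n + 1 ∧ input n (inputAddress n v) = some v := by
  cases v with
  | dim m =>
    have hm : m ≤ n := hv
    exact ⟨by simp only [inputAddress]; omega, by simp [inputAddress, input, hm]⟩
  | init i =>
    obtain ⟨h1, h2⟩ := hv
    refine ⟨by simp only [inputAddress]; omega, ?_⟩
    have : input n (n + i) = some (init i) := by
      unfold input
      rw [if_neg (by omega), if_pos (by omega), Nat.add_sub_cancel_left]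
    exact this
  | _ => exact hg.elim

open Classical in
/-- The computed vertices. -/
noncomputable def innerVertices (T : AggOrder n) : Finset MCMVertex :=
  let I := Finset.Ico 1 (n + 1)
  (((I ×ˢ I ×ˢ I).filter fun x => x.1 ≤ x.2.1 ∧ x.2.1 < x.2.2).biUnion fun x =>
      {dd x.1 x.2.1 x.2.2, ddd x.1 x.2.1 x.2.2, sum x.1 x.2.1 x.2.2}) ∪
    ((I ×ˢ I).filter fun p => p.1 < p.2).biUnion fun p =>
      (T.tree p.1 p.2).subtrees.toFinset.image (agg p.1 p.2)

/-- At most three vertices per triple, and fewer than `2n` nodes in the tree of each pair because a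
binary tree with `m` leaves has `2m - 1` nodes: `3n³ + 2n³`. -/
theorem card_innerVertices_le (T : AggOrder n) : (innerVertices T).card ≤ 5 * n ^ 3 := by
  classical
  unfold innerVertices
  refine (Finset.card_union_le _ _).trans ?_
  have h1 : ∀ x ∈ (Finset.Ico 1 (n + 1) ×ˢ Finset.Ico 1 (n + 1) ×ˢ Finset.Ico 1 (n + 1)).filter
      fun x => x.1 ≤ x.2.1 ∧ x.2.1 < x.2.2,
      ({dd x.1 x.2.1 x.2.2, ddd x.1 x.2.1 x.2.2, sum x.1 x.2.1 x.2.2} : Finset _).card ≤ 3 :=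
    fun x _ => Finset.card_le_three
  have h2 : ∀ p ∈ (Finset.Ico 1 (n + 1) ×ˢ Finset.Ico 1 (n + 1)).filter fun p => p.1 < p.2,
      ((T.tree p.1 p.2).subtrees.toFinset.image (agg p.1 p.2)).card ≤ 2 * n := by
    intro p hp
    simp only [Finset.mem_filter, Finset.mem_product, Finset.mem_Ico] at hp
    refine Finset.card_image_le.trans ((List.toFinset_card_le _).trans ?_)
    have h3 := length_subtrees (T.tree p.1 p.2)
    have h4 := (T.leaves_perm p.1 p.2 (by omega) (by omega) (by omega)).length_eq
    rw [List.length_range'] at h4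
    omega
  have h3 := Finset.card_biUnion_le_card_mul _ _ _ h1
  have h4 := Finset.card_biUnion_le_card_mul _ _ _ h2
  have h5 := Finset.card_filter_le (Finset.Ico 1 (n + 1) ×ˢ Finset.Ico 1 (n + 1))
    (fun p => p.1 < p.2)
  have h7 := Finset.card_filter_le
    (Finset.Ico 1 (n + 1) ×ˢ Finset.Ico 1 (n + 1) ×ˢ Finset.Ico 1 (n + 1))
    (fun x => x.1 ≤ x.2.1 ∧ x.2.1 < x.2.2)
  simp only [Finset.card_product, Nat.card_Ico, Nat.add_sub_cancel] at h5 h7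
  have h6 := Nat.mul_le_mul_right (2 * n) h5
  have h8 := Nat.mul_le_mul_right 3 h7
  calc _ ≤ n * (n * n) * 3 + n * n * (2 * n) :=
        Nat.add_le_add (h3.trans h8) (h4.trans h6)
    _ = 5 * n ^ 3 := by ring

theorem mem_innerVertices {T : AggOrder n} {v : MCMVertex} :
    v ∈ innerVertices T ↔ v ∈ (cdag T).verts ∧ ¬ (cdag T).IsInput v := by
  classical
  change _ ↔ IsVertex T v ∧ _
  rw [isInput_iff, not_and]
  simp only [innerVertices, Finset.mem_union, Finset.mem_biUnion, Finset.mem_product,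
    Finset.mem_Ico, Finset.mem_insert, Finset.mem_singleton, Finset.mem_filter, Finset.mem_image,
    List.mem_toFinset, mem_subtrees, Prod.exists]
  constructor
  · rintro (⟨i, k, j, h1, h2⟩ | ⟨i, j, h1, t, ht, rfl⟩)
    · rcases h2 with rfl | rfl | rfl <;>
        exact ⟨⟨h1.1.1.1, h1.2.1, h1.2.2, by omega⟩, fun _ h => h⟩
    · exact ⟨⟨h1.1.1.1, h1.2, by omega, ht⟩, fun _ h => h⟩
  · rintro ⟨h1, h2⟩
    cases v with
    | dim m => exact (h2 h1 trivial).elim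
    | init m => exact (h2 h1 trivial).elim
    | agg i j t =>
      obtain ⟨h3, h4, h5, h6⟩ := h1
      exact Or.inr ⟨i, j, ⟨by omega, h4⟩, t, h6, rfl⟩
    | dd i k j =>
      obtain ⟨h3, h4, h5, h6⟩ := h1
      exact Or.inl ⟨i, k, j, by omega, by simp⟩
    | ddd i k j =>
      obtain ⟨h3, h4, h5, h6⟩ := h1
      exact Or.inl ⟨i, k, j, by omega, by simp⟩
    | sum i k j =>
      obtain ⟨h3, h4, h5, h6⟩ := h1
      exact Or.inl ⟨i, k, j, by omega, by simp⟩

/-- There is a schedule with a number of transfers cubic in the length of the chain. -/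
theorem exists_mem_transferCounts_cubic {M B : ℕ} (hM : 2 ≤ M) (hB : 1 ≤ B) :
    ∃ q ∈ transferCounts n M B, q ≤ 15 * n ^ 3 := by
  let T : AggOrder n := .ofLists n (fun i j => List.range' i (j - i)) fun _ _ _ _ _ => .refl _
  obtain ⟨xs, h1, h2⟩ := exists_evaluates_of_binary (M := M) (B := B) (cdag T) (input n) hM hB
    (innerVertices T) (fun v => mem_innerVertices) rank (fun u v h => rank_lt h)
    (leftOperand T) (rightOperand T) (fun u v h => eq_operand h) (2 * n + 1) (inputAddress n)
    (fun v hv => input_inputAddress (isInput_iff.1 hv).1 (isInput_iff.1 hv).2)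
  refine ⟨_, ⟨T, xs, h1, rfl⟩, h2.trans ?_⟩
  have := card_innerVertices_le T
  omega

end MCM

/-! ### Block transfers on a cache with natural-number addresses -/

namespace Memory

variable {V : Type} {M : ℕ}

/-- The content of the cache at an address, empty outside the cache. -/
def word (s : Memory V M) (p : ℕ) : Option V := if h : p < M then s.cache ⟨p, h⟩ else none

theorem inCache_of_word {s : Memory V M} {p : ℕ} {v : V} (h : s.word p = some v) :
    s.InCache v := by
  unfold word at h
  split_ifs at h with hp
  exact ⟨_, h⟩

end Memory

namespace Schedule

open Memory

variable {V : Type} {M : ℕ} {G : CDAG V} {B : ℕ}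

theorem Run.read (s : Memory V M) {a p b : ℕ} (hb : b ≤ B) (hp : p + b ≤ M) :
    ∃ s', Run G B s s' 1 ∅ ∧ s'.slow = s.slow ∧
      ∀ q, s'.word q = if p ≤ q ∧ q < p + b then s.slow (a + (q - p)) else s.word q := by
  refine ⟨_, Run.single_transfer (x := .read a p b) ⟨hb, hp⟩ rfl, rfl, fun q => ?_⟩
  simp only [word, MemAction.effect]
  by_cases hq : q < M
  · simp [hq]
  · rw [if_neg (by omega)]
    simp [hq]

theorem Run.write (s : Memory V M) {a p b : ℕ} (hb : b ≤ B) (hp : p + b ≤ M) :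
    ∃ s', Run G B s s' 1 ∅ ∧ s'.word = s.word ∧
      ∀ x, s'.slow x = if a ≤ x ∧ x < a + b then s.word (p + (x - a)) else s.slow x :=
  ⟨_, Run.single_transfer (x := .write p a b) ⟨hb, hp⟩ rfl, rfl, fun _ => rfl⟩

theorem Run.copy (s : Memory V M) {p q : ℕ} (hp : p < M) (hq : q < M) :
    ∃ s', Run G B s s' 0 ∅ ∧ s'.slow = s.slow ∧
      ∀ r, s'.word r = if r = q then s.word p else s.word r := by
  refine ⟨_, Run.single_transfer (x := .copy ⟨p, hp⟩ ⟨q, hq⟩) trivial rfl, rfl, fun r => ?_⟩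
  simp only [word, MemAction.effect, Fin.mk.injEq]
  by_cases hr : r < M
  · simp [hr, hp]
  · rw [if_neg (by omega)]
    simp [hr]

theorem Run.compute (s : Memory V M) {v : V} {p : ℕ} (hp : p < M) (hv : v ∈ G.verts)
    (hv' : ¬ G.IsInput v) (hop : ∀ u, G.Adj u v → ∃ q, s.word q = some u) :
    ∃ s', Run G B s s' 0 {v} ∧ s'.slow = s.slow ∧
      ∀ r, s'.word r = if r = p then some v else s.word r := by
  refine ⟨_, Run.single_compute (v := v) (p := ⟨p, hp⟩) ⟨hv, hv', fun u hu => ?_⟩, rfl,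
    fun r => ?_⟩
  · obtain ⟨q, hq⟩ := hop u hu
    exact inCache_of_word hq
  · simp only [word, MemAction.effect, Fin.mk.injEq]
    by_cases hr : r < M
    · simp [hr]
    · rw [if_neg (by omega)]
      simp [hr]

/-- Full blocks of `B` words are peeled off until at most `B` words remain for one last read. -/
theorem Run.readBlock (hB : 1 ≤ B) (len : ℕ) (s : Memory V M) (a p : ℕ) (hp : p + len ≤ M) :
    ∃ s', Run G B s s' (len / B + 1) ∅ ∧ s'.slow = s.slow ∧
      ∀ q, s'.word q = if p ≤ q ∧ q < p + len then s.slow (a + (q - p)) else s.word q := by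
  induction len using Nat.strong_induction_on generalizing s a p with
  | _ len ih =>
    rcases le_or_gt len B with h | h
    · obtain ⟨s', h1, h2, h3⟩ := Run.read (G := G) (B := B) s (a := a) (p := p) h hp
      exact ⟨s', h1.mono (Nat.le_add_left 1 _) subset_rfl, h2, h3⟩
    · obtain ⟨s1, h1, h2, h3⟩ := Run.read (G := G) (B := B) s (a := a) (p := p) (b := B) le_rfl
        (by omega)
      obtain ⟨s2, k1, k2, k3⟩ := ih (len - B) (by omega) s1 (a + B) (p + B) (by omega)
      refine ⟨s2, (h1.transfer_trans k1).mono ?_ subset_rfl, k2.trans h2, fun q => ?_⟩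
      · have : len / B = (len - B) / B + 1 := Nat.div_eq_sub_div (by omega) h.le
        omega
      · rw [k3, h3, h2]
        by_cases hq : p + B ≤ q ∧ q < p + len
        · rw [if_pos (by omega), if_pos (by omega)]
          congr 1
          omega
        · rw [if_neg (by omega)]
          by_cases hq2 : p ≤ q ∧ q < p + B
          · rw [if_pos hq2, if_pos (by omega)]
          · rw [if_neg hq2, if_neg (by omega)]

theorem Run.writeBlock (hB : 1 ≤ B) (len : ℕ) (s : Memory V M) (a p : ℕ) (hp : p + len ≤ M) :
    ∃ s', Run G B s s' (len / B + 1) ∅ ∧ s'.word = s.word ∧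
      ∀ x, s'.slow x = if a ≤ x ∧ x < a + len then s.word (p + (x - a)) else s.slow x := by
  induction len using Nat.strong_induction_on generalizing s a p with
  | _ len ih =>
    rcases le_or_gt len B with h | h
    · obtain ⟨s', h1, h2, h3⟩ := Run.write (G := G) (B := B) s (a := a) (p := p) h hp
      exact ⟨s', h1.mono (Nat.le_add_left 1 _) subset_rfl, h2, h3⟩
    · obtain ⟨s1, h1, h2, h3⟩ := Run.write (G := G) (B := B) s (a := a) (p := p) (b := B) le_rfl
        (by omega)
      obtain ⟨s2, k1, k2, k3⟩ := ih (len - B) (by omega) s1 (a + B) (p + B) (by omega)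
      refine ⟨s2, (h1.transfer_trans k1).mono ?_ subset_rfl, k2.trans h2, fun q => ?_⟩
      · have : len / B = (len - B) / B + 1 := Nat.div_eq_sub_div (by omega) h.le
        omega
      · rw [k3, h3, h2]
        by_cases hq : a + B ≤ q ∧ q < a + len
        · rw [if_pos (by omega), if_pos (by omega)]
          congr 1
          omega
        · rw [if_neg (by omega)]
          by_cases hq2 : a ≤ q ∧ q < a + B
          · rw [if_pos hq2, if_pos (by omega)]
          · rw [if_neg hq2, if_neg (by omega)]

end Schedule

/-! ### Processing the split positions of one subproblem -/

namespace AggTree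

/-- The last leaf of a tree. -/
def lastLeaf : AggTree → ℕ
  | leaf k => k
  | node _ r => r.lastLeaf

end AggTree

namespace MCM

open MCMVertex AggTree Schedule Memory

variable {n : ℕ} {T : AggOrder n} {M B : ℕ}

/-- The triple `(i - 1, k, j)` for which a value is computed. -/
def triple : MCMVertex → ℕ × ℕ × ℕ
  | dd i k j => (i - 1, k, j)
  | ddd i k j => (i - 1, k, j)
  | sum i k j => (i - 1, k, j)
  | agg i j t => (i - 1, t.lastLeaf, j)
  | _ => (0, 0, 0)

/-- The word `o` holds the minimum over the split positions `l` of the subproblem between the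
dimensions `a` and `b`. -/
def Acc (a b : ℕ) (l : List ℕ) (o : Option MCMVertex) : Prop :=
  (b = a + 1 → o = some (init b)) ∧ (l ≠ [] → o = some (agg (a + 1) b (comb l)))

/-- Processing one split position, with auxiliary cache words `p₀`, `p₁` and the partial minimum
in the cache word `p`. -/
theorem run_triple (s : Memory MCMVertex M) {a k b p₀ p₁ p : ℕ} (hak : a < k) (hkb : k < b)
    (hb : b ≤ n) (hp₀ : p₀ < M) (hp₁ : p₁ < M) (hp : p < M) (h01 : p₀ ≠ p₁) (h0 : p₀ ≠ p)
    (h1 : p₁ ≠ p) {l : List ℕ} (hl : IsSubtree (comb (l ++ [k])) (T.tree (a + 1) b))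
    (hacc : l ≠ [] → s.word p = some (agg (a + 1) b (comb l)))
    (hS₁ : ∃ q, s.word q = some (S T (a + 1) k)) (hS₂ : ∃ q, s.word q = some (S T (k + 1) b))
    (hd : ∀ m, m = a ∨ m = k ∨ m = b → ∃ q, q ≠ p₀ ∧ q ≠ p₁ ∧ s.word q = some (dim m)) :
    ∃ s', Run (cdag T) B s s' 0 {v | triple v = (a, k, b)} ∧ s'.slow = s.slow ∧
      s'.word p = some (agg (a + 1) b (comb (l ++ [k]))) ∧
      ∀ q, q ≠ p₀ → q ≠ p₁ → q ≠ p → s'.word q = s.word q := by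
  have hV : 1 ≤ a + 1 ∧ a + 1 ≤ k ∧ k < b ∧ b ≤ n := ⟨by omega, by omega, hkb, hb⟩
  have hleaf : IsVertex T (agg (a + 1) b (leaf k)) :=
    ⟨hV.1, by omega, hb, isSubtree_leaf hV.1 hV.2.1 hkb hb⟩
  -- The sum comes first because its operands are allowed to sit in the scratch words. It goes to
  -- `p₁`; the two products and the leaf then overwrite each other in `p₀`, so two scratch words
  -- suffice.
  obtain ⟨s1, r1, e1, w1⟩ := Run.compute (G := cdag T) (B := B) s (v := sum (a + 1) k b) hp₁ hV
    (not_isInput (.sum_left hV)) (fun u hu => by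
      change Operand T u _ at hu
      rcases eq_operand hu with rfl | rfl
      · exact hS₁
      · exact hS₂)
  have hd1 : ∀ m, m = a ∨ m = k ∨ m = b →
      ∃ q, q ≠ p₀ ∧ q ≠ p₁ ∧ s1.word q = some (dim m) := by
    intro m hm
    obtain ⟨q, h2, h3, h4⟩ := hd m hm
    exact ⟨q, h2, h3, by rw [w1, if_neg h3, h4]⟩
  obtain ⟨s2, r2, e2, w2⟩ := Run.compute (G := cdag T) (B := B) s1 (v := dd (a + 1) k b) hp₀ hV
    (not_isInput (.dd_left hV)) (fun u hu => by
      change Operand T u _ at hu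
      rcases eq_operand hu with rfl | rfl
      · obtain ⟨q, -, -, h⟩ := hd1 a (by simp)
        exact ⟨q, h⟩
      · obtain ⟨q, -, -, h⟩ := hd1 k (by simp)
        exact ⟨q, h⟩)
  obtain ⟨s3, r3, e3, w3⟩ := Run.compute (G := cdag T) (B := B) s2 (v := ddd (a + 1) k b) hp₀ hV
    (not_isInput (.ddd_left hV)) (fun u hu => by
      change Operand T u _ at hu
      rcases eq_operand hu with rfl | rfl
      · exact ⟨p₀, by rw [w2, if_pos rfl]; rfl⟩
      · obtain ⟨q, h2, -, h⟩ := hd1 b (by simp)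
        exact ⟨q, by rw [w2, if_neg h2, h]; rfl⟩)
  obtain ⟨s4, r4, e4, w4⟩ := Run.compute (G := cdag T) (B := B) s3
    (v := agg (a + 1) b (leaf k)) hp₀ hleaf
    (not_isInput (.leaf_left hleaf)) (fun u hu => by
      change Operand T u _ at hu
      rcases eq_operand hu with rfl | rfl
      · exact ⟨p₁, by rw [w3, if_neg h01.symm, w2, if_neg h01.symm, w1, if_pos rfl]; rfl⟩
      · exact ⟨p₀, by rw [w3, if_pos rfl]; rfl⟩)
  have r1234 := (((r1.trans r2 (by simp)).trans r3 (by simp)).trans r4 (by simp)).mono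
    (D' := {sum (a + 1) k b, dd (a + 1) k b, ddd (a + 1) k b, agg (a + 1) b (leaf k)}) le_rfl
    (by intro v hv; simp only [Set.mem_union, Set.mem_singleton_iff] at hv; simp; tauto)
  have hsl : s4.slow = s.slow := by rw [e4, e3, e2, e1]
  have hframe : ∀ q, q ≠ p₀ → q ≠ p₁ → s4.word q = s.word q := by
    intro q h2 h3
    rw [w4, if_neg h2, w3, if_neg h2, w2, if_neg h2, w1, if_neg h3]
  have hp4 : s4.word p₀ = some (agg (a + 1) b (leaf k)) := by rw [w4, if_pos rfl]
  -- The first split position needs no minimum: its leaf is copied to the accumulator. Later ones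
  -- are combined with the comb already there. All vertices computed here have last split `k`, so
  -- they carry the label `(a,k,b)`.
  rcases eq_or_ne l [] with rfl | hne
  · obtain ⟨s5, r5, e5, w5⟩ := Run.copy (G := cdag T) (B := B) s4 hp₀ hp
    refine ⟨s5, (r1234.trans_transfer r5).mono le_rfl ?_, e5.trans hsl, ?_, ?_⟩
    · rintro v (rfl | rfl | rfl | rfl) <;> rfl
    · rw [w5, if_pos rfl, hp4]; rfl
    · intro q h2 h3 h4
      rw [w5, if_neg h4, hframe q h2 h3]
  · rw [comb_append_singleton hne] at hl
    have hnode : IsVertex T (agg (a + 1) b (node (comb l) (leaf k))) :=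
      ⟨hV.1, by omega, hb, hl⟩
    obtain ⟨s5, r5, e5, w5⟩ := Run.compute (G := cdag T) (B := B) s4
      (v := agg (a + 1) b (node (comb l) (leaf k))) hp hnode
      (not_isInput (.node_left hnode)) (fun u hu => by
        change Operand T u _ at hu
        rcases eq_operand hu with rfl | rfl
        · exact ⟨p, by rw [hframe p h0.symm h1.symm, hacc hne]; rfl⟩
        · exact ⟨p₀, hp4⟩)
    refine ⟨s5, (r1234.trans r5 (by simp)).mono le_rfl ?_, e5.trans hsl, ?_, ?_⟩
    · rintro v ((rfl | rfl | rfl | rfl) | rfl) <;> rfl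
    · rw [w5, if_pos rfl, comb_append_singleton hne]
    · intro q h2 h3 h4
      rw [w5, if_neg h4, hframe q h2 h3]

/-- Processing a list of split positions of one subproblem. -/
theorem run_splits (s : Memory MCMVertex M) {a b p₀ p₁ p : ℕ}
    (hb : b ≤ n) (hp₀ : p₀ < M) (hp₁ : p₁ < M) (hp : p < M) (h01 : p₀ ≠ p₁) (h0 : p₀ ≠ p)
    (h1 : p₁ ≠ p) {l ks rest : List ℕ} (hT : T.tree (a + 1) b = comb (l ++ ks ++ rest))
    (hnd : ks.Nodup) (hks : ∀ k ∈ ks, a < k ∧ k < b) (hacc : Acc a b l (s.word p))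
    (hav : ∀ k ∈ ks, ∀ v, v = S T (a + 1) k ∨ v = S T (k + 1) b ∨ v = dim a ∨ v = dim k ∨
      v = dim b → ∃ q, q ≠ p₀ ∧ q ≠ p₁ ∧ q ≠ p ∧ s.word q = some v) :
    ∃ s', Run (cdag T) B s s' 0
        {v | (triple v).1 = a ∧ (triple v).2.2 = b ∧ (triple v).2.1 ∈ ks} ∧
      s'.slow = s.slow ∧ Acc a b (l ++ ks) (s'.word p) ∧
      ∀ q, q ≠ p₀ → q ≠ p₁ → q ≠ p → s'.word q = s.word q := by
  obtain ⟨s', r, e1, e2, e3⟩ := Run.loop (G := cdag T) (B := B) ks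
    (fun pre s' => s'.slow = s.slow ∧ Acc a b (l ++ pre) (s'.word p) ∧
      ∀ q, q ≠ p₀ → q ≠ p₁ → q ≠ p → s'.word q = s.word q) 0
    (fun k => {v | triple v = (a, k, b)}) (hnd.imp fun {x y} hxy => by
      rw [Set.disjoint_left]
      intro v hv hv'
      simp only [Set.mem_ofPred_eq] at hv hv'
      rw [hv] at hv'
      simp only [Prod.mk.injEq] at hv'
      exact hxy hv'.2.1) (by
      rintro pre k suf s' hk ⟨i1, i2, i3⟩
      have hkm : k ∈ ks := by simp [hk]
      have hav' : ∀ v, v = S T (a + 1) k ∨ v = S T (k + 1) b ∨ v = dim a ∨ v = dim k ∨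
          v = dim b → ∃ q, q ≠ p₀ ∧ q ≠ p₁ ∧ s'.word q = some v := by
        intro v hv
        obtain ⟨q, q1, q2, q3, q4⟩ := hav k hkm v hv
        exact ⟨q, q1, q2, by rw [i3 q q1 q2 q3, q4]⟩
      obtain ⟨s'', r, k1, k2, k3⟩ := run_triple (T := T) (B := B) s' (hks k hkm).1 (hks k hkm).2 hb
        hp₀ hp₁ hp h01 h0 h1 (l := l ++ pre) (by
          rw [hT, hk]
          have := isSubtree_comb (l := l ++ pre ++ [k]) (m := suf ++ rest) (by simp)
          simpa using this) i2.2
        (by obtain ⟨q, -, -, h⟩ := hav' (S T (a + 1) k) (by simp); exact ⟨q, h⟩)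
        (by obtain ⟨q, -, -, h⟩ := hav' (S T (k + 1) b) (by simp); exact ⟨q, h⟩)
        (by
          rintro m (rfl | rfl | rfl)
          · exact hav' _ (by simp)
          · exact hav' _ (by simp)
          · exact hav' _ (by simp))
      refine ⟨s'', r, k1.trans i1, ⟨fun h => ?_, fun _ => ?_⟩, fun q q1 q2 q3 => ?_⟩
      · have := hks k hkm
        omega
      · rw [k2, List.append_assoc]
      · rw [k3 q q1 q2 q3, i3 q q1 q2 q3])
    s ⟨rfl, by rwa [List.append_nil], fun _ _ _ _ => rfl⟩
  refine ⟨s', r.mono (by simp) ?_, e1, e2, e3⟩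
  rintro v ⟨k, hk, hv⟩
  simp only [Set.mem_ofPred_eq] at hv ⊢
  rw [hv]
  exact ⟨rfl, rfl, hk⟩

end MCM

/-! ### Tiles of subproblems -/

namespace MCM

open MCMVertex AggTree Schedule Memory

variable {n : ℕ} {T : AggOrder n} {M B t : ℕ}

/-- Position of the entry `(a,b)` in its tile. -/
def offset (t a b : ℕ) : ℕ := a % t * t + b % t

theorem offset_lt (ht : 0 < t) (a b : ℕ) : offset t a b < t * t := by
  have h1 := Nat.mod_lt a ht
  have h2 := Nat.mod_lt b ht
  unfold offset
  nlinarith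

/-- Inside a fixed tile the two remainders are the base-`t` digits of the offset, so distinct cells
occupy distinct words. -/
theorem eq_of_offset_eq (ht : 0 < t) {a b a' b' : ℕ} (ha : a / t = a' / t) (hb : b / t = b' / t)
    (h : offset t a b = offset t a' b') : a = a' ∧ b = b' := by
  have h1 := Nat.mod_lt b ht
  have h2 := Nat.mod_lt b' ht
  unfold offset at h
  have h3 : b % t = b' % t := by
    have := congrArg (· % t) h
    simpa [Nat.mul_add_mod_self_right, Nat.mod_eq_of_lt h1, Nat.mod_eq_of_lt h2] using this
  have h4 : a % t = a' % t := by
    rw [h3] at h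
    exact Nat.eq_of_mul_eq_mul_right ht (Nat.add_right_cancel h)
  constructor
  · rw [← Nat.div_add_mod a t, ← Nat.div_add_mod a' t, ha, h4]
  · rw [← Nat.div_add_mod b t, ← Nat.div_add_mod b' t, hb, h3]

/-- The subproblems between the dimensions in the blocks `I` and `J`. -/
def cells (n t I J : ℕ) : Finset (ℕ × ℕ) :=
  (Finset.range (n + 1) ×ˢ Finset.range (n + 1)).filter fun p =>
    p.1 < p.2 ∧ p.1 / t = I ∧ p.2 / t = J

theorem mem_cells {I J : ℕ} {p : ℕ × ℕ} :
    p ∈ cells n t I J ↔ p.1 < p.2 ∧ p.2 ≤ n ∧ p.1 / t = I ∧ p.2 / t = J := by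
  simp only [cells, Finset.mem_filter, Finset.mem_product, Finset.mem_range]
  omega

/-- The cache word for the entry `(a,b)` of the tile being computed. -/
def target (t : ℕ) (p : ℕ × ℕ) : ℕ := 2 * (t * t) + offset t p.1 p.2

/-- Processing some split positions of all subproblems of a tile. Words `7t²` and `8t²` are
auxiliary. -/
theorem run_cells (ht : 0 < t) (hM : 9 * (t * t) ≤ M) {I J : ℕ} (s : Memory MCMVertex M)
    (P ks rest : ℕ → ℕ → List ℕ)
    (hT : ∀ p ∈ cells n t I J,
      T.tree (p.1 + 1) p.2 = comb (P p.1 p.2 ++ ks p.1 p.2 ++ rest p.1 p.2))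
    (hnd : ∀ p ∈ cells n t I J, (ks p.1 p.2).Nodup)
    (hks : ∀ p ∈ cells n t I J, ∀ k ∈ ks p.1 p.2, p.1 < k ∧ k < p.2)
    (hacc : ∀ p ∈ cells n t I J, Acc p.1 p.2 (P p.1 p.2) (s.word (target t p)))
    (hav : ∀ s' : Memory MCMVertex M,
      (∀ q < 7 * (t * t), q < 2 * (t * t) ∨ 3 * (t * t) ≤ q → s'.word q = s.word q) →
      ∀ p ∈ cells n t I J, (∀ p' ∈ cells n t I J, p'.2 - p'.1 < p.2 - p.1 →
        Acc p'.1 p'.2 (P p'.1 p'.2 ++ ks p'.1 p'.2) (s'.word (target t p'))) →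
      ∀ k ∈ ks p.1 p.2, ∀ v, v = S T (p.1 + 1) k ∨ v = S T (k + 1) p.2 ∨ v = dim p.1 ∨
        v = dim k ∨ v = dim p.2 → ∃ q < 7 * (t * t), q ≠ target t p ∧ s'.word q = some v) :
    ∃ s', Run (cdag T) B s s' 0 {v | ((triple v).1, (triple v).2.2) ∈ cells n t I J ∧
        (triple v).2.1 ∈ ks (triple v).1 (triple v).2.2} ∧
      s'.slow = s.slow ∧
      (∀ q < 7 * (t * t), q < 2 * (t * t) ∨ 3 * (t * t) ≤ q → s'.word q = s.word q) ∧
      ∀ p ∈ cells n t I J, Acc p.1 p.2 (P p.1 p.2 ++ ks p.1 p.2) (s'.word (target t p)) := by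
  -- Increasing length `b - a`: when operands lie in the tile being computed, they belong to shorter
  -- subproblems and are already finished for this phase.
  obtain ⟨l, lnd, lmem, -, lsort⟩ :=
    (cells n t I J).exists_list_sorted_by fun p => p.2 - p.1
  have htt : 0 < t * t := Nat.mul_pos ht ht
  have htarget : ∀ p, 2 * (t * t) ≤ target t p ∧ target t p < 3 * (t * t) := by
    intro p
    have := offset_lt ht p.1 p.2
    unfold target
    omega
  have hinj : ∀ p ∈ cells n t I J, ∀ p' ∈ cells n t I J, target t p = target t p' → p = p' := by
    intro p hp p' hp' h
    rw [mem_cells] at hp hp'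
    obtain ⟨h1, h2⟩ := eq_of_offset_eq ht (hp.2.2.1.trans hp'.2.2.1.symm)
      (hp.2.2.2.trans hp'.2.2.2.symm) (Nat.add_left_cancel h)
    exact Prod.ext h1 h2
  obtain ⟨s', r, e1, e2, e3, -⟩ := Run.loop (G := cdag T) (B := B) l
    (fun pre s' => s'.slow = s.slow ∧
      (∀ q < 7 * (t * t), q < 2 * (t * t) ∨ 3 * (t * t) ≤ q → s'.word q = s.word q) ∧
      (∀ p ∈ pre, Acc p.1 p.2 (P p.1 p.2 ++ ks p.1 p.2) (s'.word (target t p))) ∧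
      ∀ p ∈ cells n t I J, p ∉ pre → Acc p.1 p.2 (P p.1 p.2) (s'.word (target t p))) 0
    (fun p => {v | (triple v).1 = p.1 ∧ (triple v).2.2 = p.2 ∧ (triple v).2.1 ∈ ks p.1 p.2})
    (lnd.imp fun {x y} hxy => by
      rw [Set.disjoint_left]
      rintro v ⟨h1, h2, -⟩ ⟨h3, h4, -⟩
      exact hxy (Prod.ext (h1.symm.trans h3) (h2.symm.trans h4))) (by
      rintro pre p suf s' hl ⟨i1, i2, i3, i4⟩
      have hpl : p ∈ l := by simp [hl]
      have hp := (lmem p).1 hpl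
      have hppre : p ∉ pre := by
        rw [hl] at lnd
        intro h
        exact (List.disjoint_of_nodup_append lnd) h (by simp)
      have htp := htarget p
      obtain ⟨s'', r, k1, k2, k3⟩ := run_splits (T := T) (B := B) s' (a := p.1) (b := p.2)
        (p₀ := 7 * (t * t)) (p₁ := 8 * (t * t)) (p := target t p) (mem_cells.1 hp).2.1
        (by omega) (by omega) (by omega) (by omega) (by omega) (by omega) (hT p hp) (hnd p hp)
        (hks p hp) (i4 p hp hppre) (by
          intro k hk v hv
          obtain ⟨q, q1, q2, q3⟩ := hav s' i2 p hp
            (fun p' hp' hlt => i3 p' (lsort pre p suf hl p' hp' hlt)) k hk v hv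
          exact ⟨q, by omega, by omega, q2, q3⟩)
      have hframe : ∀ p' ∈ cells n t I J, p' ≠ p →
          s''.word (target t p') = s'.word (target t p') := by
        intro p' hp' hne
        have := htarget p'
        exact k3 _ (by omega) (by omega) fun h => hne (hinj p' hp' p hp h)
      refine ⟨s'', r, k1.trans i1, fun q q1 q2 => ?_, fun p' hp' => ?_, fun p' hp' hn => ?_⟩
      · rw [k3 q (by omega) (by omega) (by omega), i2 q q1 q2]
      · rcases List.mem_append.1 hp' with h | h
        · have hp'c : p' ∈ cells n t I J := (lmem p').1 (by simp [hl, h])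
          rw [hframe p' hp'c (fun h' => hppre (h' ▸ h))]
          exact i3 p' h
        · rw [List.mem_singleton] at h
          rw [h]
          exact k2
      · simp only [List.mem_append, List.mem_singleton, not_or] at hn
        rw [hframe p' hp' hn.2]
        exact i4 p' hp' hn.1)
    s ⟨rfl, fun _ _ _ => rfl, by simp, fun p hp _ => hacc p hp⟩
  refine ⟨s', r.mono (by simp) ?_, e1, e2, fun p hp => e3 p ((lmem p).2 hp)⟩
  rintro v ⟨p, hp, h1, h2, h3⟩
  simp only [Set.mem_ofPred_eq]
  rw [h1, h2]
  exact ⟨(lmem p).1 hp, h3⟩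

/-! ### The tiled aggregation order -/

/-- The phase in which the split position `k` is processed in the tile `(I,J)`. -/
def phase (t I J k : ℕ) : ℕ := if I < k / t ∧ k / t < J then k / t else J

/-- The split positions between `a` and `b` processed in phase `κ`. -/
def splits (t κ a b : ℕ) : List ℕ :=
  (List.range' (a + 1) (b - a - 1)).filter fun k => phase t (a / t) (b / t) k = κ

/-- All split positions between `a` and `b`, in the order in which they are processed. -/
def splitOrder (t a b : ℕ) : List ℕ :=
  (List.range' (a / t + 1) (b / t - a / t - 1)).flatMap (fun κ => splits t κ a b) ++
    splits t (b / t) a b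

theorem mem_splits {κ a b k : ℕ} (hab : a < b) :
    k ∈ splits t κ a b ↔ a < k ∧ k < b ∧ phase t (a / t) (b / t) k = κ := by
  simp only [splits, List.mem_filter, List.mem_range'_1, decide_eq_true_eq]
  omega

theorem nodup_splits {κ a b : ℕ} : (splits t κ a b).Nodup :=
  List.Nodup.filter _ List.nodup_range'

/-- `phase` assigns each split position to exactly one phase: its own block if that lies strictly
between the end blocks, and the last phase otherwise. -/
theorem splitOrder_perm {a b : ℕ} (hab : a < b) :
    (splitOrder t a b).Perm (List.range' (a + 1) (b - a - 1)) := by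
  have hnd : (splitOrder t a b).Nodup := by
    unfold splitOrder
    rw [List.nodup_append]
    refine ⟨List.nodup_flatMap.2 ⟨fun _ _ => nodup_splits, ?_⟩, nodup_splits, ?_⟩
    · refine (List.nodup_range' (s := a / t + 1) (n := b / t - a / t - 1)).imp fun {x y} hxy => ?_
      intro k hk hk'
      rw [mem_splits hab] at hk hk'
      exact hxy (hk.2.2.symm.trans hk'.2.2)
    · intro k hk k' hk' hkk
      subst hkk
      obtain ⟨κ, hκ, hk⟩ := List.mem_flatMap.1 hk
      rw [mem_splits hab] at hk hk'
      rw [List.mem_range'_1] at hκ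
      have := hk.2.2.symm.trans hk'.2.2
      omega
  rw [List.perm_ext_iff_of_nodup hnd List.nodup_range']
  intro k
  simp only [splitOrder, List.mem_append, List.mem_flatMap, mem_splits hab, List.mem_range'_1]
  constructor
  · rintro (⟨κ, -, h1, h2, -⟩ | ⟨h1, h2, -⟩) <;> omega
  · intro h
    by_cases hk : a / t < k / t ∧ k / t < b / t
    · left
      exact ⟨k / t, by omega, by omega, by omega, by simp [phase, hk]⟩
    · right
      exact ⟨by omega, by omega, by simp only [phase, hk, if_false]⟩

/-- The aggregation order of the tiled schedule. -/
def tiledOrder (n t : ℕ) : AggOrder n :=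
  .ofLists n (fun i j => splitOrder t (i - 1) j) fun i j h1 h2 h3 => by
    have := splitOrder_perm (t := t) (a := i - 1) (b := j) (by omega)
    rwa [show i - 1 + 1 = i by omega, show j - (i - 1) - 1 = j - i by omega] at this

theorem tiledOrder_tree {a b : ℕ} :
    (tiledOrder n t).tree (a + 1) b = comb (splitOrder t a b) := rfl

/-- For `b = a + 1` there is nothing to minimize and the clause on `init` applies. Otherwise the
list is nonempty and its comb is the whole aggregation tree. -/
theorem eq_S_of_acc {a b : ℕ} (hab : a < b) {o : Option MCMVertex}
    (h : Acc a b (splitOrder t a b) o) : o = some (S (tiledOrder n t) (a + 1) b) := by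
  rcases (Nat.succ_le_of_lt hab).eq_or_lt with h1 | h1
  · rw [h.1 h1.symm, ← h1]
    exact congrArg some S_self.symm
  · rw [S_of_lt h1, tiledOrder_tree]
    refine h.2 fun h0 => ?_
    have := (splitOrder_perm (t := t) hab).length_eq
    rw [h0, List.length_range'] at this
    simp at this
    omega

end MCM

/-! ### Computing one tile in the cache -/

namespace Schedule

open Memory

variable {V : Type} {M : ℕ} {G : CDAG V} {B : ℕ}

/-- Reading a block of `m` words into the `ρ`-th region of the cache. -/
theorem Run.load (hB : 1 ≤ B) (s : Memory V M) (m ρ a : ℕ) (hρ : ρ * m + m ≤ M) :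
    ∃ s', Run G B s s' (m / B + 1) ∅ ∧ s'.slow = s.slow ∧
      (∀ x < m, s'.word (ρ * m + x) = s.slow (a + x)) ∧
      ∀ q, q < ρ * m ∨ ρ * m + m ≤ q → s'.word q = s.word q := by
  obtain ⟨s', r, h1, h2⟩ := Run.readBlock (G := G) hB m s a (ρ * m) hρ
  refine ⟨s', r, h1, fun x hx => ?_, fun q hq => ?_⟩
  · rw [h2, if_pos (by omega), Nat.add_sub_cancel_left]
  · rw [h2, if_neg (by omega)]

end Schedule

namespace MCM

open MCMVertex AggTree Schedule Memory

variable {n M B t : ℕ}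

/-- The slow memory address of a tile. -/
def tileAddress (n t I J : ℕ) : ℕ := 2 * n + 1 + Nat.pair I J * (t * t)

/-- The tile `(I,J)` of solutions is in slow memory. -/
def Stored (n t : ℕ) (s : Memory MCMVertex M) (I J : ℕ) : Prop :=
  ∀ p ∈ cells n t I J, s.slow (tileAddress n t I J + offset t p.1 p.2) =
    some (S (tiledOrder n t) (p.1 + 1) p.2)

/-- The input is still in slow memory. -/
def InputKept (n : ℕ) (s : Memory MCMVertex M) : Prop := ∀ x ≤ 2 * n, s.slow x = input n x

theorem InputKept.slow_dim {s : Memory MCMVertex M} (h : InputKept n s) {a : ℕ} (ha : a ≤ n) :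
    s.slow (t * (a / t) + a % t) = some (dim a) := by
  rw [Nat.div_add_mod, h a (by omega)]
  simp [input, ha]

/-- Lets a block of `t` dimensions or initial values live in a region of `t²` words, so that all
cache regions have the same size. -/
theorem mod_lt_sq (ht : 0 < t) (a : ℕ) : a % t < t * t :=
  (Nat.mod_lt a ht).trans_le (Nat.le_mul_of_pos_left t ht)

/-- One phase of the computation of the tile `(I,J)`. -/
theorem run_phase (ht : 0 < t) (hM : 9 * (t * t) ≤ M) (hB : 1 ≤ B) {I J κ K : ℕ}
    (s : Memory MCMVertex M) (P rest : ℕ → ℕ → List ℕ) (hin : InputKept n s)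
    (hI : ∀ a ≤ n, a / t = I → s.word (3 * (t * t) + a % t) = some (dim a))
    (hJ : ∀ a ≤ n, a / t = J → s.word (4 * (t * t) + a % t) = some (dim a))
    (hT : ∀ p ∈ cells n t I J,
      splitOrder t p.1 p.2 = P p.1 p.2 ++ splits t κ p.1 p.2 ++ rest p.1 p.2)
    (hacc : ∀ p ∈ cells n t I J, Acc p.1 p.2 (P p.1 p.2) (s.word (target t p)))
    (hleft : ∀ p ∈ cells n t I J, ∀ k ∈ splits t κ p.1 p.2, (k / t = K ∧ Stored n t s I K) ∨
      (k / t = J ∧ ∀ p' ∈ cells n t I J,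
        P p'.1 p'.2 ++ splits t κ p'.1 p'.2 = splitOrder t p'.1 p'.2))
    (hright : ∀ p ∈ cells n t I J, ∀ k ∈ splits t κ p.1 p.2, (k / t = κ ∧ Stored n t s κ J) ∨
      (k / t = I ∧ ∀ p' ∈ cells n t I J,
        P p'.1 p'.2 ++ splits t κ p'.1 p'.2 = splitOrder t p'.1 p'.2)) :
    ∃ s', Run (cdag (tiledOrder n t)) B s s' (3 * (t * t / B + 1))
        {v | ((triple v).1, (triple v).2.2) ∈ cells n t I J ∧ phase t I J (triple v).2.1 = κ} ∧
      s'.slow = s.slow ∧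
      (∀ q, 3 * (t * t) ≤ q → q < 5 * (t * t) → s'.word q = s.word q) ∧
      ∀ p ∈ cells n t I J,
        Acc p.1 p.2 (P p.1 p.2 ++ splits t κ p.1 p.2) (s'.word (target t p)) := by
  have htt : 0 < t * t := Nat.mul_pos ht ht
  -- Cache layout in regions of `t²` words: 0 and 1 hold the left and right operand tiles, 2 the
  -- target tile, 3, 4 and 5 the dimensions of blocks `I`, `J` and `κ`, 6 the initial values; 7 and
  -- 8 are scratch.
  obtain ⟨s1, r1, e1, l1, f1⟩ := Run.load (G := cdag (tiledOrder n t)) hB s (t * t) 0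
    (tileAddress n t I K) (by omega)
  obtain ⟨s2, r2, e2, l2, f2⟩ := Run.load (G := cdag (tiledOrder n t)) hB s1 (t * t) 1
    (tileAddress n t κ J) (by omega)
  obtain ⟨s3, r3, e3, l3, f3⟩ := Run.load (G := cdag (tiledOrder n t)) hB s2 (t * t) 5
    (t * κ) (by omega)
  have hfr : ∀ q, 2 * (t * t) ≤ q → q < 5 * (t * t) → s3.word q = s.word q := by
    intro q h1 h2
    rw [f3 q (by omega), f2 q (by omega), f1 q (by omega)]
  have wA : ∀ x < t * t, s3.word x = s.slow (tileAddress n t I K + x) := by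
    intro x hx
    rw [f3 x (by omega), f2 x (by omega), ← l1 x hx]
    congr 1
    omega
  have wB : ∀ x < t * t, s3.word (t * t + x) = s.slow (tileAddress n t κ J + x) := by
    intro x hx
    rw [f3 _ (by omega), ← e1, ← l2 x hx]
    congr 1
    omega
  have wK : ∀ k ≤ n, k / t = κ → s3.word (5 * (t * t) + k % t) = some (dim k) := by
    intro k hk hkκ
    rw [l3 _ (mod_lt_sq ht k), e2, e1, ← hkκ]
    exact hin.slow_dim hk
  have htarget : ∀ p ∈ cells n t I J, target t p < 3 * (t * t) ∧ 2 * (t * t) ≤ target t p := by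
    intro p _
    have := offset_lt ht p.1 p.2
    unfold target
    omega
  obtain ⟨s4, r4, e4, f4, h4⟩ := run_cells (T := tiledOrder n t) (B := B) ht hM (I := I) (J := J)
    s3 P (splits t κ) rest (fun p hp => by rw [tiledOrder_tree, hT p hp])
    (fun p _ => nodup_splits)
    (fun p hp k hk => by
      rw [mem_splits (mem_cells.1 hp).1] at hk
      exact ⟨hk.1, hk.2.1⟩)
    (fun p hp => by
      have := htarget p hp
      rw [hfr _ (by omega) (by omega)]
      exact hacc p hp)
    (by
      intro s' hs' p hp hprev k hk v hv
      obtain ⟨c1, c2, c3, c4⟩ := mem_cells.1 hp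
      obtain ⟨k1, k2, -⟩ := (mem_splits c1).1 hk
      have hmod := mod_lt_sq ht
      have htp := htarget p hp
      have hdI : ∀ a ≤ n, a / t = I →
          ∃ q < 7 * (t * t), q ≠ target t p ∧ s'.word q = some (dim a) := by
        intro a ha haI
        have := hmod a
        refine ⟨3 * (t * t) + a % t, by omega, by omega, ?_⟩
        rw [hs' _ (by omega) (by omega), hfr _ (by omega) (by omega), hI a ha haI]
      rcases hv with rfl | rfl | rfl | rfl | rfl
      -- The left operand `(a,k)` is in the loaded tile, or in the target tile itself when `k` is in
      -- block `J`. In the latter case `hfull` says that this phase is the last, so the shorter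
      -- entry already holds its final value.
      · rcases hleft p hp k hk with ⟨hkK, hst⟩ | ⟨hkJ, hfull⟩
        · have hoff := offset_lt ht p.1 k
          refine ⟨offset t p.1 k, by omega, by omega, ?_⟩
          rw [hs' _ (by omega) (by omega), wA _ hoff]
          exact hst (p.1, k) (mem_cells.2 ⟨k1, by simp only; omega, c3, hkK⟩)
        · have hp' : (p.1, k) ∈ cells n t I J := mem_cells.2 ⟨k1, by simp only; omega, c3, hkJ⟩
          have := htarget _ hp'
          refine ⟨target t (p.1, k), by omega, ?_, ?_⟩
          · intro h
            have := (eq_of_offset_eq ht rfl (hkJ.trans c4.symm) (Nat.add_left_cancel h)).2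
            omega
          · have h := hprev _ hp' (by simp only; omega)
            rw [hfull _ hp'] at h
            exact eq_S_of_acc k1 h
      · rcases hright p hp k hk with ⟨hkK, hst⟩ | ⟨hkI, hfull⟩
        · have hoff := offset_lt ht k p.2
          refine ⟨t * t + offset t k p.2, by omega, by omega, ?_⟩
          rw [hs' _ (by omega) (by omega), wB _ hoff]
          exact hst (k, p.2) (mem_cells.2 ⟨k2, c2, hkK, c4⟩)
        · have hp' : (k, p.2) ∈ cells n t I J := mem_cells.2 ⟨k2, c2, hkI, c4⟩
          have := htarget _ hp'
          refine ⟨target t (k, p.2), by omega, ?_, ?_⟩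
          · intro h
            have := (eq_of_offset_eq ht (hkI.trans c3.symm) rfl (Nat.add_left_cancel h)).1
            omega
          · have h := hprev _ hp' (by simp only; omega)
            rw [hfull _ hp'] at h
            exact eq_S_of_acc k2 h
      · exact hdI _ (by omega) c3
      · rcases hright p hp k hk with ⟨hkK, -⟩ | ⟨hkI, -⟩
        · have := hmod k
          refine ⟨5 * (t * t) + k % t, by omega, by omega, ?_⟩
          rw [hs' _ (by omega) (by omega), wK k (by omega) hkK]
        · exact hdI k (by omega) hkI
      · have := hmod p.2
        refine ⟨4 * (t * t) + p.2 % t, by omega, by omega, ?_⟩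
        rw [hs' _ (by omega) (by omega), hfr _ (by omega) (by omega), hJ p.2 c2 c4])
  refine ⟨s4, (((r1.transfer_trans r2).transfer_trans r3).transfer_trans r4).mono (by omega) ?_,
    by rw [e4, e3, e2, e1], fun q h1 h2 => ?_, h4⟩
  · rintro v ⟨hv1, hv2⟩
    obtain ⟨c1, c2, c3, c4⟩ := mem_cells.1 hv1
    have := ((mem_splits c1).1 hv2).2.2
    simp only at c3 c4
    rw [c3, c4] at this
    exact ⟨hv1, this⟩
  · rw [f4 q (by omega) (by omega), hfr q (by omega) h2]

/-- Putting the given values `S(b,b)` of the tile `(I,J)` into place. -/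
theorem run_init (ht : 0 < t) (hM : 9 * (t * t) ≤ M) {I J : ℕ} (s : Memory MCMVertex M)
    (hinit : ∀ a < n, a / t = I → s.word (6 * (t * t) + a % t) = some (init (a + 1))) :
    ∃ s', Run (cdag (tiledOrder n t)) B s s' 0 ∅ ∧ s'.slow = s.slow ∧
      (∀ q, 3 * (t * t) ≤ q → s'.word q = s.word q) ∧
      ∀ p ∈ cells n t I J, Acc p.1 p.2 [] (s'.word (target t p)) := by
  have htarget : ∀ p, target t p < 3 * (t * t) := by
    intro p
    have := offset_lt ht p.1 p.2
    unfold target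
    omega
  obtain ⟨s', r, e1, e2, e3⟩ := Run.loop (G := cdag (tiledOrder n t)) (B := B)
    (cells n t I J).toList
    (fun pre s' => s'.slow = s.slow ∧ (∀ q, 3 * (t * t) ≤ q → s'.word q = s.word q) ∧
      ∀ p ∈ pre, p ∈ cells n t I J → p.2 = p.1 + 1 → s'.word (target t p) = some (init p.2)) 0
    (fun _ => ∅) (List.pairwise_of_forall fun _ _ => by simp) (by
      rintro pre p suf s' hl ⟨i1, i2, i3⟩
      have hp : p ∈ cells n t I J := by
        rw [← Finset.mem_toList, hl]
        simp
      obtain ⟨c1, c2, c3, c4⟩ := mem_cells.1 hp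
      have hmod := mod_lt_sq ht p.1
      have htp := htarget p
      obtain ⟨s'', r, k1, k2⟩ := Run.copy (G := cdag (tiledOrder n t)) (B := B) s'
        (p := 6 * (t * t) + p.1 % t) (q := target t p) (by omega) (by omega)
      refine ⟨s'', r, k1.trans i1, fun q hq => ?_, fun p' hp' hc' h => ?_⟩
      · rw [k2, if_neg (by omega), i2 q hq]
      · obtain ⟨d1, d2, d3, d4⟩ := mem_cells.1 hc'
        rw [k2]
        split_ifs with htt
        · obtain ⟨h1, h2⟩ := eq_of_offset_eq ht (d3.trans c3.symm) (d4.trans c4.symm)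
            (Nat.add_left_cancel htt)
          rw [i2 _ (by omega), hinit p.1 (by omega) c3, h, h1]
        · rcases List.mem_append.1 hp' with hp' | hp'
          · exact i3 p' hp' hc' h
          · exact absurd (congrArg (target t) (List.mem_singleton.1 hp')) htt)
    s ⟨rfl, fun _ _ => rfl, by simp⟩
  exact ⟨s', r.mono (by simp) (by simp), e1, e2, fun p hp =>
    ⟨e3 p (Finset.mem_toList.2 hp) hp, fun h => absurd rfl h⟩⟩

/-- The computation of the tile `(I,J)`. -/
theorem run_tile (ht : 0 < t) (hM : 9 * (t * t) ≤ M) (hB : 1 ≤ B) {I J : ℕ} (hIJ : I ≤ J)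
    (s : Memory MCMVertex M) (hin : InputKept n s)
    (hrow : ∀ K, I ≤ K → K < J → Stored n t s I K)
    (hcol : ∀ K, I < K → K ≤ J → Stored n t s K J) :
    ∃ s', Run (cdag (tiledOrder n t)) B s s' ((3 * J + 7) * (t * t / B + 1))
        {v | ((triple v).1, (triple v).2.2) ∈ cells n t I J} ∧
      InputKept n s' ∧ Stored n t s' I J ∧
      ∀ I' J', (I', J') ≠ (I, J) → Stored n t s I' J' → Stored n t s' I' J' := by
  have htt : 0 < t * t := Nat.mul_pos ht ht
  have hmod := mod_lt_sq ht
  obtain ⟨w, hw⟩ : ∃ w, w = t * t / B + 1 := ⟨_, rfl⟩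
  obtain ⟨s1, r1, e1, l1, f1⟩ := Run.load (G := cdag (tiledOrder n t)) hB s (t * t) 3
    (t * I) (by omega)
  obtain ⟨s2, r2, e2, l2, f2⟩ := Run.load (G := cdag (tiledOrder n t)) hB s1 (t * t) 4
    (t * J) (by omega)
  obtain ⟨s3, r3, e3, l3, f3⟩ := Run.load (G := cdag (tiledOrder n t)) hB s2 (t * t) 6
    (n + 1 + t * I) (by omega)
  obtain ⟨s4, r4, e4, f4, h4⟩ := run_init (n := n) (B := B) ht hM (I := I) (J := J) s3 (by
    intro a ha haI
    rw [l3 _ (hmod a), e2, e1, ← haI, add_assoc, Nat.div_add_mod, hin _ (by omega)]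
    unfold input
    rw [if_neg (by omega), if_pos (by omega)]
    congr 2
    omega)
  rw [← hw] at r1 r2 r3
  have hs4 : s4.slow = s.slow := by rw [e4, e3, e2, e1]
  have hI : ∀ a ≤ n, a / t = I → s4.word (3 * (t * t) + a % t) = some (dim a) := by
    intro a ha haI
    have := hmod a
    rw [f4 _ (by omega), f3 _ (by omega), f2 _ (by omega), l1 _ this, ← haI]
    exact hin.slow_dim ha
  have hJ : ∀ a ≤ n, a / t = J → s4.word (4 * (t * t) + a % t) = some (dim a) := by
    intro a ha haJ
    have := hmod a
    rw [f4 _ (by omega), f3 _ (by omega), l2 _ this, e1, ← haJ]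
    exact hin.slow_dim ha
  obtain ⟨s5, r5, e5, f5, h5⟩ := Run.loop (G := cdag (tiledOrder n t)) (B := B)
    (List.range' (I + 1) (J - I - 1))
    (fun pre s' => s'.slow = s.slow ∧
      (∀ q, 3 * (t * t) ≤ q → q < 5 * (t * t) → s'.word q = s4.word q) ∧
      ∀ p ∈ cells n t I J, Acc p.1 p.2 (pre.flatMap fun κ => splits t κ p.1 p.2)
        (s'.word (target t p))) (3 * w)
    (fun κ => {v | ((triple v).1, (triple v).2.2) ∈ cells n t I J ∧
      phase t I J (triple v).2.1 = κ})
    ((List.nodup_range' (s := I + 1) (n := J - I - 1)).imp fun {x y} hxy => by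
      rw [Set.disjoint_left]
      rintro v ⟨-, h1⟩ ⟨-, h2⟩
      exact hxy (h1.symm.trans h2)) (by
      rintro pre κ suf s' hl ⟨i1, i2, i3⟩
      have hκ : κ ∈ List.range' (I + 1) (J - I - 1) := by rw [hl]; simp
      rw [List.mem_range'_1] at hκ
      have hphase : ∀ p ∈ cells n t I J, ∀ k ∈ splits t κ p.1 p.2, k / t = κ := by
        intro p hp k hk
        obtain ⟨c1, c2, c3, c4⟩ := mem_cells.1 hp
        have := ((mem_splits c1).1 hk).2.2
        rw [c3, c4] at this
        unfold phase at this
        split_ifs at this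
        · exact this
        · omega
      have hstored : ∀ I' J', Stored n t s I' J' → Stored n t s' I' J' := by
        intro I' J' h p hp
        rw [i1]
        exact h p hp
      obtain ⟨s'', r, k1, k2, k3⟩ := run_phase (n := n) ht hM hB (I := I) (J := J) (κ := κ)
        (K := κ) s' (fun a b => pre.flatMap fun κ => splits t κ a b)
        (fun a b => (suf.flatMap fun κ => splits t κ a b) ++ splits t J a b)
        (fun x hx => by rw [i1]; exact hin x hx)
        (fun a ha haI => by
          have := hmod a
          rw [i2 _ (by omega) (by omega), hI a ha haI])
        (fun a ha haJ => by
          have := hmod a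
          rw [i2 _ (by omega) (by omega), hJ a ha haJ])
        (fun p hp => by
          obtain ⟨c1, c2, c3, c4⟩ := mem_cells.1 hp
          unfold splitOrder
          rw [c3, c4, hl]
          simp) i3
        (fun p hp k hk => Or.inl ⟨hphase p hp k hk, hstored _ _ (hrow κ (by omega) (by omega))⟩)
        (fun p hp k hk => Or.inl ⟨hphase p hp k hk, hstored _ _ (hcol κ (by omega) (by omega))⟩)
      rw [← hw] at r
      refine ⟨s'', r, k1.trans i1, fun q q1 q2 => ?_, fun p hp => ?_⟩
      · rw [k2 q q1 q2, i2 q q1 q2]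
      · have := k3 p hp
        simpa using this)
    s4 ⟨hs4, fun _ _ _ => rfl, by simpa using h4⟩
  have hfull : ∀ p ∈ cells n t I J, splitOrder t p.1 p.2 =
      ((List.range' (I + 1) (J - I - 1)).flatMap fun κ => splits t κ p.1 p.2) ++
        splits t J p.1 p.2 := by
    intro p hp
    obtain ⟨c1, c2, c3, c4⟩ := mem_cells.1 hp
    unfold splitOrder
    rw [c3, c4]
  have hphase : ∀ p ∈ cells n t I J, ∀ k ∈ splits t J p.1 p.2, k / t = I ∨ k / t = J := by
    intro p hp k hk
    obtain ⟨c1, c2, c3, c4⟩ := mem_cells.1 hp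
    obtain ⟨k1, k2, k3⟩ := (mem_splits c1).1 hk
    have h1 : I ≤ k / t := c3 ▸ Nat.div_le_div_right k1.le
    have h2 : k / t ≤ J := c4 ▸ Nat.div_le_div_right k2.le
    rw [c3, c4] at k3
    unfold phase at k3
    split_ifs at k3 with h
    · exact Or.inr k3
    · omega
  have hstored : ∀ I' J', Stored n t s I' J' → Stored n t s5 I' J' := by
    intro I' J' h p hp
    rw [e5]
    exact h p hp
  obtain ⟨s6, r6, e6, f6, h6⟩ := run_phase (n := n) ht hM hB (I := I) (J := J) (κ := J) (K := I)
    s5 (fun a b => (List.range' (I + 1) (J - I - 1)).flatMap fun κ => splits t κ a b)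
    (fun _ _ => []) (fun x hx => by rw [e5]; exact hin x hx)
    (fun a ha haI => by
      have := hmod a
      rw [f5 _ (by omega) (by omega), hI a ha haI])
    (fun a ha haJ => by
      have := hmod a
      rw [f5 _ (by omega) (by omega), hJ a ha haJ])
    (fun p hp => by rw [hfull p hp, List.append_nil]) h5
    (fun p hp k hk => by
      by_cases hkJ : k / t = J
      · exact Or.inr ⟨hkJ, fun p' hp' => (hfull p' hp').symm⟩
      · have hkI := (hphase p hp k hk).resolve_right hkJ
        exact Or.inl ⟨hkI, hstored _ _ (hrow I le_rfl (by omega))⟩)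
    (fun p hp k hk => by
      by_cases hkI : k / t = I
      · exact Or.inr ⟨hkI, fun p' hp' => (hfull p' hp').symm⟩
      · have hkJ := (hphase p hp k hk).resolve_left hkI
        exact Or.inl ⟨hkJ, hstored _ _ (hcol J (by omega) le_rfl)⟩)
  rw [← hw] at r6
  obtain ⟨s7, r7, e7, f7⟩ := Run.writeBlock (G := cdag (tiledOrder n t)) hB (t * t) s6
    (tileAddress n t I J) (2 * (t * t)) (by omega)
  rw [← hw] at r7 ⊢
  have hs6 : s6.slow = s.slow := by rw [e6, e5]
  rw [hs6] at f7
  have rA := ((r1.transfer_trans r2).transfer_trans r3).transfer_trans r4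
  refine ⟨s7, ((rA.transfer_trans (r5.trans r6 ?_)).trans_transfer r7).mono ?_ ?_, ?_, ?_, ?_⟩
  · rw [Set.disjoint_left]
    rintro v ⟨κ, hκ, -, h1⟩ ⟨-, h2⟩
    rw [List.mem_range'_1] at hκ
    have := h1.symm.trans h2
    omega
  · rw [List.length_range']
    have : J - I - 1 ≤ J := by omega
    have := Nat.mul_le_mul_right (3 * w) this
    linarith
  · rintro v (⟨κ, -, h, -⟩ | ⟨h, -⟩) <;> exact h
  · intro x hx
    rw [f7, if_neg (by unfold tileAddress; omega)]
    exact hin x hx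
  · intro p hp
    have := offset_lt ht p.1 p.2
    rw [f7, if_pos (by omega), Nat.add_sub_cancel_left]
    have := h6 p hp
    rw [← hfull p hp] at this
    exact eq_S_of_acc (mem_cells.1 hp).1 this
  · intro I' J' hne hst p hp
    have h1 := offset_lt ht p.1 p.2
    have hpair : Nat.pair I' J' ≠ Nat.pair I J := fun h => hne (by
      rw [Nat.pair_eq_pair] at h
      exact Prod.ext h.1 h.2)
    rw [f7, if_neg ?_]
    · exact hst p hp
    · unfold tileAddress
      rcases Nat.lt_or_gt_of_ne hpair with h | h
      · have := Nat.mul_le_mul_right (t * t) (Nat.succ_le_of_lt h)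
        rw [Nat.succ_mul] at this
        omega
      · have := Nat.mul_le_mul_right (t * t) (Nat.succ_le_of_lt h)
        rw [Nat.succ_mul] at this
        omega

end MCM

namespace AggTree

/-- A proper subtree has a parent. -/
theorem IsSubtree.eq_or_parent {t : AggTree} : ∀ {U : AggTree}, IsSubtree t U →
    t = U ∨ ∃ u, IsSubtree (node t u) U ∨ IsSubtree (node u t) U
  | leaf _, h => Or.inl h
  | node a b, h => by
      rcases h with h | h | h
      · exact Or.inl h
      · right
        rcases IsSubtree.eq_or_parent h with rfl | ⟨u, hu | hu⟩
        · exact ⟨b, Or.inl (sub_refl _)⟩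
        · exact ⟨u, Or.inl (Or.inr (Or.inl hu))⟩
        · exact ⟨u, Or.inr (Or.inr (Or.inl hu))⟩
      · right
        rcases IsSubtree.eq_or_parent h with rfl | ⟨u, hu | hu⟩
        · exact ⟨a, Or.inr (sub_refl _)⟩
        · exact ⟨u, Or.inl (Or.inr (Or.inr hu))⟩
        · exact ⟨u, Or.inr (Or.inr (Or.inr hu))⟩

end AggTree

namespace MCM

open MCMVertex AggTree Schedule Memory

variable {n M B t : ℕ}

theorem eq_full_of_not_operand {T : AggOrder n} {i j : ℕ} (hi : 1 ≤ i) (hij : i ≤ j) (hj : j ≤ n)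
    (h : ∀ w, ¬ Operand T (S T i j) w) : i = 1 ∧ j = n := by
  constructor
  · by_contra hne
    have := Operand.sum_right (T := T) (i := 1) (k := i - 1) (j := j)
      ⟨by omega, by omega, by omega, by omega⟩
    rw [show i - 1 + 1 = i by omega] at this
    exact h _ this
  · by_contra hne
    exact h _ (.sum_left (i := i) (k := j) (j := n) ⟨hi, hij, by omega, le_rfl⟩)

theorem eq_S_of_isOutput {T : AggOrder n} (hn : 2 ≤ n) {v : MCMVertex}
    (hv : (cdag T).IsOutput v) : v = S T 1 n := by
  obtain ⟨hV, h⟩ := hv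
  change IsVertex T v at hV
  change ∀ w, ¬ Operand T v w at h
  cases v with
  | dim m =>
    exfalso
    have hm : m ≤ n := hV
    rcases Nat.eq_zero_or_pos m with rfl | h0
    · exact h _ (.dd_left (i := 1) (k := 1) (j := n) ⟨by omega, by omega, by omega, by omega⟩)
    · rcases hm.lt_or_eq with hlt | rfl
      · exact h _ (.dd_right (i := 1) (k := m) (j := n) ⟨by omega, by omega, by omega, by omega⟩)
      · exact h _ (.ddd_right (i := 1) (k := 1) (j := m)
          ⟨by omega, by omega, by omega, by omega⟩)
  | init i =>
    have := eq_full_of_not_operand (T := T) hV.1 le_rfl hV.2 (by rw [S_self]; exact h)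
    omega
  | dd i k j => exact (h _ (.ddd_left hV)).elim
  | ddd i k j =>
    obtain ⟨h1, h2, h3, h4⟩ := hV
    exact (h _ (.leaf_right ⟨h1, by omega, h4, isSubtree_leaf h1 h2 h3 h4⟩)).elim
  | sum i k j =>
    obtain ⟨h1, h2, h3, h4⟩ := hV
    exact (h _ (.leaf_left ⟨h1, by omega, h4, isSubtree_leaf h1 h2 h3 h4⟩)).elim
  | agg i j u =>
    obtain ⟨h1, h2, h3, h4⟩ := hV
    rcases IsSubtree.eq_or_parent h4 with rfl | ⟨u', hu | hu⟩
    · rw [← S_of_lt h2] at h ⊢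
      obtain ⟨rfl, rfl⟩ := eq_full_of_not_operand h1 h2.le h3 h
      rfl
    · exact (h _ (.node_left ⟨h1, h2, h3, hu⟩)).elim
    · exact (h _ (.node_right ⟨h1, h2, h3, hu⟩)).elim

/-- The number of transfers of the tiled schedule. -/
theorem exists_mem_transferCounts_tiled (hn : 2 ≤ n) (ht : 0 < t) (hM : 9 * (t * t) ≤ M)
    (hB : 1 ≤ B) :
    ∃ q ∈ transferCounts n M B, q ≤ 7 * (n / t + 1) ^ 3 * (t * t / B + 1) := by
  obtain ⟨N, hN⟩ : ∃ N, N = n / t + 1 := ⟨_, rfl⟩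
  obtain ⟨l, lnd, lmem, llen, lsort⟩ :=
    ((Finset.range N ×ˢ Finset.range N).filter fun p => p.1 ≤ p.2).exists_list_sorted_by
      fun p => p.2 - p.1
  obtain ⟨s', ⟨xs, h1, h2, h3, h4, -⟩, i1, i2⟩ := Run.loop (G := cdag (tiledOrder n t)) (B := B) l
    (fun pre s => InputKept n s ∧ ∀ p ∈ pre, Stored (M := M) n t s p.1 p.2)
    ((3 * N + 4) * (t * t / B + 1))
    (fun p => {v | ((triple v).1, (triple v).2.2) ∈ cells n t p.1 p.2})
    (lnd.imp fun {x y} hxy => by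
      rw [Set.disjoint_left]
      intro v hv hv'
      have c := mem_cells.1 hv
      have c' := mem_cells.1 hv'
      exact hxy (Prod.ext (c.2.2.1.symm.trans c'.2.2.1) (c.2.2.2.symm.trans c'.2.2.2))) (by
      rintro pre ⟨I, J⟩ suf s hl ⟨j1, j2⟩
      have hp := (lmem (I, J)).1 (by rw [hl]; simp)
      simp only [Finset.mem_filter, Finset.mem_product, Finset.mem_range] at hp
      have hst : ∀ I' J', I' ≤ J' → J' < N → J' - I' < J - I → Stored n t s I' J' := by
        intro I' J' k1 k2 k3
        exact j2 (I', J') (lsort pre _ suf hl (I', J') (by simp; omega) k3)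
      obtain ⟨s', r, k1, k2, k3⟩ := run_tile (n := n) ht hM hB hp.2 s j1
        (fun K g1 g2 => hst _ _ g1 (by omega) (by omega))
        (fun K g1 g2 => hst _ _ g2 (by omega) (by omega))
      refine ⟨s', r.mono (Nat.mul_le_mul_right _ (by omega)) subset_rfl, k1, fun p' hp' => ?_⟩
      by_cases h : p' = (I, J)
      · rw [h]
        exact k2
      · exact k3 _ _ h (j2 p' ((List.mem_append.1 hp').resolve_right (by simpa using h))))
    ⟨fun _ => none, input n⟩ ⟨fun _ _ => rfl, by simp⟩
  refine ⟨_, ⟨tiledOrder n t, xs, ⟨h1, h4, fun v hv => ?_⟩, rfl⟩, h3.trans ?_⟩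
  · rw [eq_S_of_isOutput hn hv, h2]
    refine ⟨_, i2 (0, n / t) ((lmem _).2 ?_) (0, n) (mem_cells.2 ⟨?_, le_rfl, ?_, rfl⟩)⟩
    · simp [hN]
    · simp only; omega
    · simp
  · rw [← hN, ← mul_assoc]
    refine Nat.mul_le_mul_right _ ?_
    have hl : l.length ≤ N * N := by
      rw [llen]
      refine (Finset.card_filter_le _ _).trans ?_
      simp
    have hN1 : 1 ≤ N := hN ▸ Nat.succ_pos _
    calc l.length * (3 * N + 4) ≤ N * N * (7 * N) := Nat.mul_le_mul hl (by omega)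
      _ = 7 * N ^ 3 := by ring

/-- The upper bound. -/
theorem exists_mem_transferCounts_le (hn : 2 ≤ n) (hM : 2 ≤ M) (hB : 1 ≤ B) (hBM : B ≤ M)
    (hMn : M ≤ n ^ 2) :
    ∃ q ∈ transferCounts n M B,
      (q : ℝ) ≤ 50000 * ((n : ℝ) ^ 3 / ((B : ℝ) * Real.sqrt (M : ℝ))) := by
  set r := Real.sqrt M with hr
  have hr2 : r ^ 2 = M := Real.sq_sqrt (Nat.cast_nonneg M)
  have hM0 : (0 : ℝ) < M := by exact_mod_cast (by omega : 0 < M)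
  have hB0 : (0 : ℝ) < B := by exact_mod_cast hB
  have hBM' : (B : ℝ) ≤ M := by exact_mod_cast hBM
  have hr0 : 0 < r := Real.sqrt_pos.2 hM0
  rcases lt_or_ge M 9 with h9 | h9
  · obtain ⟨q, hq, hle⟩ := exists_mem_transferCounts_cubic (n := n) hM hB
    refine ⟨q, hq, ?_⟩
    have hle' : (q : ℝ) ≤ 15 * (n : ℝ) ^ 3 := by exact_mod_cast hle
    have hM9 : (M : ℝ) ≤ 9 := by exact_mod_cast h9.le
    have hr3 : r ≤ 3 := by nlinarith
    have hBr : (B : ℝ) * r ≤ 9 * 3 := by gcongr; linarith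
    rw [mul_div_assoc', le_div_iff₀ (by positivity)]
    calc (q : ℝ) * (B * r) ≤ 15 * (n : ℝ) ^ 3 * (9 * 3) := by gcongr
      _ ≤ 50000 * (n : ℝ) ^ 3 := by
        have : (0 : ℝ) ≤ (n : ℝ) ^ 3 := by positivity
        linarith
  · obtain ⟨t, ht⟩ : ∃ t, t = Nat.sqrt (M / 9) := ⟨_, rfl⟩
    have ht1 : t * t ≤ M / 9 := ht ▸ Nat.sqrt_le _
    have ht2 : M / 9 < (t + 1) * (t + 1) := ht ▸ Nat.lt_succ_sqrt _
    have ht0 : 0 < t := by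
      rcases Nat.eq_zero_or_pos t with h | h
      · rw [h] at ht2
        omega
      · exact h
    obtain ⟨q, hq, hle⟩ := exists_mem_transferCounts_tiled (n := n) (M := M) hn ht0 (by omega) hB
    refine ⟨q, hq, ?_⟩
    have htR : (0 : ℝ) < t := by exact_mod_cast ht0
    have htM : (t : ℝ) * t ≤ M := by exact_mod_cast (by omega : t * t ≤ M)
    have hrt : r ≤ 6 * t := by
      refine Real.sqrt_le_iff.2 ⟨by positivity, ?_⟩
      have h : M ≤ 9 * ((t + 1) * (t + 1)) := by omega
      have h' : M ≤ (6 * t) ^ 2 := h.trans (by nlinarith)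
      exact_mod_cast h'
    have htn : (t : ℝ) ≤ n := by
      have : t ≤ n := (Nat.pow_le_pow_iff_left two_ne_zero).1 (by rw [sq]; omega)
      exact_mod_cast this
    have h1 : ((n / t : ℕ) : ℝ) + 1 ≤ 2 * (n / t) := by
      have h2 : ((n / t : ℕ) : ℝ) ≤ n / t := Nat.cast_div_le
      have h3 : (1 : ℝ) ≤ n / t := by rwa [one_le_div htR]
      linarith
    have h2 : ((t * t / B : ℕ) : ℝ) + 1 ≤ 2 * M / B := by
      have h3 : ((t * t / B : ℕ) : ℝ) ≤ ((t * t : ℕ) : ℝ) / B := Nat.cast_div_le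
      push_cast at h3
      have h4 : (t : ℝ) * t / B ≤ M / B := by gcongr
      have h5 : (1 : ℝ) ≤ M / B := by rwa [one_le_div hB0]
      have h6 : 2 * (M : ℝ) / B = M / B + M / B := by ring
      linarith
    have hle' : (q : ℝ) ≤ 7 * (((n / t : ℕ) : ℝ) + 1) ^ 3 * (((t * t / B : ℕ) : ℝ) + 1) := by
      exact_mod_cast hle
    have hr3 : r ^ 3 ≤ (6 * (t : ℝ)) ^ 3 := by gcongr
    rw [mul_div_assoc', le_div_iff₀ (by positivity)]
    calc (q : ℝ) * (B * r)
        ≤ 7 * (2 * ((n : ℝ) / t)) ^ 3 * (2 * M / B) * (B * r) := by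
          refine mul_le_mul_of_nonneg_right (hle'.trans ?_) (by positivity)
          gcongr
      _ = 112 * (n : ℝ) ^ 3 * (r ^ 3 / (t : ℝ) ^ 3) := by
          rw [← hr2]
          field_simp
          ring
      _ ≤ 112 * (n : ℝ) ^ 3 * 216 := by
          gcongr
          rw [div_le_iff₀ (by positivity)]
          exact hr3.trans (le_of_eq (by ring))
      _ ≤ 50000 * (n : ℝ) ^ 3 := by
          have : (0 : ℝ) ≤ (n : ℝ) ^ 3 := by positivity
          linarith

end MCM

theorem mainTheorem6 :
    ∃ c : ℝ, 0 < c ∧ ∃ c₁ : ℝ, 0 < c₁ ∧ ∃ c₂ : ℝ, 0 < c₂ ∧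
      ∀ n M B : ℕ, 2 ≤ M → 1 ≤ B → B ≤ M → (M : ℝ) < c * (n : ℝ) ^ 2 →
        ∃ q : ℕ, IsLeast (MCM.transferCounts n M B) q ∧
          c₁ * ((n : ℝ) ^ 3 / ((B : ℝ) * Real.sqrt (M : ℝ))) ≤ (q : ℝ) ∧
          (q : ℝ) ≤ c₂ * ((n : ℝ) ^ 3 / ((B : ℝ) * Real.sqrt (M : ℝ))) := by
  refine ⟨1 / 10 ^ 14, by positivity, 1 / 256000, by positivity, 50000, by positivity, ?_⟩
  intro n M B hM hB hBM hMn
  have hsqrt : Real.sqrt M * 10 ^ 7 ≤ n := by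
    have h : Real.sqrt M ≤ n / 10 ^ 7 := by
      refine Real.sqrt_le_iff.2 ⟨by positivity, hMn.le.trans (le_of_eq ?_)⟩
      ring
    rwa [le_div_iff₀ (by positivity)] at h
  have hMn' : M ≤ n ^ 2 := by
    have : (M : ℝ) ≤ (n : ℝ) ^ 2 := by
      have : (0 : ℝ) ≤ (n : ℝ) ^ 2 := by positivity
      linarith
    exact_mod_cast this
  have hn : 2 ≤ n := by nlinarith
  obtain ⟨q, hq, hle⟩ := MCM.exists_mem_transferCounts_le hn hM hB hBM hMn'
  classical
  have hex : ∃ q, q ∈ MCM.transferCounts n M B := ⟨q, hq⟩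
  refine ⟨Nat.find hex, ⟨Nat.find_spec hex, fun x hx => Nat.find_min' hex hx⟩,
    MCM.le_of_mem_transferCounts hB hBM hsqrt (Nat.find_spec hex), le_trans ?_ hle⟩
  exact_mod_cast Nat.find_min' hex hq
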